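/- Let $N\ge 1$, $\eta>0$, $\alpha\in\mathbb R$, and let $m\ge -1$ be an integer. For $E=(E_1,\dots,E_N)\in\mathbb R^N$ let $$Z(E,\eta)=\int_{S_N}d\Phi\; e^{-N\,\mathrm{Tr}\left(E\Phi^2+\frac{\eta}{4}\Phi^4\right)},$$ where on the right $E$ stands for $\mathrm{diag}(E_1,\dots,E_N)$, $S_N$ is the space of real symmetric $N\times N$ matrices and $d\Phi=\prod_{i}d\Phi_{ii}\prod_{i<j}d\Phi_{ij}$. Let $$\mathcal L_{SD}=\frac{\eta}{N}\sum_{i=1}^N\frac{\partial^2}{\partial E_i^2}+\frac{\eta}{N}\sum_{l\neq i}\frac{1}{E_i-E_l}\frac{\partial}{\partial E_i}-2\sum_{k=1}^N E_k\frac{\partial}{\partial E_k}-\frac{N(N+1)}{2}.$$ Let $K_{ij}$ be the operator that exchanges the coordinates $E_i$ and $E_j$, let $$D_i^E=\frac{\partial}{\partial E_i}+\frac12\sum_{j\ne i}\frac{1}{E_i-E_j}(1-K_{ij})$$ be the Dunkl operators with $\beta=\frac12$, and put $y_i=\sqrt{N/\eta}\,E_i$ and $D_i=\sqrt{\eta/N}\,D_i^E$,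 i.e. $D_i$ is the Dunkl operator in the variables $y$. Let $a_i=\frac1{\sqrt2}(y_i+D_i)$, $a_i^\dagger=\frac1{\sqrt2}(y_i-D_i)$, $$L_{-m}=\sum_{i=1}^N\left(\alpha\,(a_i^\dagger)^{m+1}a_i+(1-\alpha)\,a_i(a_i^\dagger)^{m+1}\right),\qquad \widetilde L_{-m}=e^{\frac12\sum_j y_j^2}\,L_{-m}\,e^{-\frac12\sum_j y_j^2}.$$ Then the integral defining $Z$ converges absolutely for every $E\in\mathbb R^N$, $Z(\cdot,\eta)$ is smooth on $\mathbb R^N$, $\widetilde L_{-m}Z$ is smooth on the set of all $E\in\mathbb R^N$ with pairwise distinct coordinates, and on that set $$\mathcal L_{SD}\left(\widetilde L_{-m}Z(E,\eta)\right)=-2m\,\widetilde L_{-m}Z(E,\eta).$$ That is, $\widetilde L_{-m}Z$, unless it vanishes identically, is an eigenfunction of $\mathcal L_{SD}$ with eigenvalue $-2m$. -/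

import Mathlib

open MeasureTheory
open scoped ContDiff

noncomputable section

namespace SymPhi4

/-! ### The real symmetric matrix model -/

/-- Index set of the independent entries `Φ i j`, `i ≤ j`, of a real symmetric matrix. -/
abbrev UpperIndex (N : ℕ) : Type := {p : Fin N × Fin N // p.1 ≤ p.2}

/-- The real symmetric matrix with prescribed entries on and above the diagonal. -/
def symMatrix {N : ℕ} (x : UpperIndex N → ℝ) : Matrix (Fin N) (Fin N) ℝ :=
  Matrix.of fun i j => x ⟨(min i j, max i j), min_le_max⟩

/-- The action `S[Φ] = N Tr (H Φ² + (η/4) Φ⁴)`. -/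
def action {N : ℕ} (η : ℝ) (H Φ : Matrix (Fin N) (Fin N) ℝ) : ℝ :=
  (N : ℝ) * (H * Φ ^ 2 + (η / 4) • Φ ^ 4).trace

/-- The Boltzmann weight `exp (-S)` in the coordinates `Φ i j`, `i ≤ j`. -/
def weight {N : ℕ} (η : ℝ) (H : Matrix (Fin N) (Fin N) ℝ) (x : UpperIndex N → ℝ) : ℝ :=
  Real.exp (-action η H (symMatrix x))

/-- The partition function with respect to `dΦ = ∏ i, dΦ i i * ∏ i < j, dΦ i j`. -/
def partitionFunction {N : ℕ} (η : ℝ) (H : Matrix (Fin N) (Fin N) ℝ) : ℝ :=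
  ∫ x : UpperIndex N → ℝ, weight η H x

/-- The partition function as a function of the eigenvalues `E` of the external matrix. -/
def Z (N : ℕ) (η : ℝ) (E : Fin N → ℝ) : ℝ :=
  partitionFunction η (Matrix.diagonal E)

/-! ### Operators on functions of `E`

All operators act on functions of `E ∈ ℝᴺ`. They are meaningful on the open, permutation
invariant set of `E` with pairwise distinct coordinates: the value there of an operator applied
to `f` depends only on the restriction of `f` to that set. -/

/-- Points with pairwise distinct coordinates. -/
def distinctPoints (N : ℕ) : Set (Fin N → ℝ) := {E | Function.Injective E}

/-- The partial derivative `∂f/∂E_i`. -/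
def partialE {N : ℕ} (i : Fin N) (f : (Fin N → ℝ) → ℝ) : (Fin N → ℝ) → ℝ :=
  fun E => fderiv ℝ f E (Pi.single i 1)

/-- The Schwinger-Dyson operator in the eigenvalues,
`(η/N) ∑_i ∂_i² + (η/N) ∑_{l ≠ i} (E_i - E_l)⁻¹ ∂_i - 2 ∑_k E_k ∂_k - N(N+1)/2`. -/
def LSD (N : ℕ) (η : ℝ) (f : (Fin N → ℝ) → ℝ) : (Fin N → ℝ) → ℝ :=
  fun E =>
    η / N * ∑ i, partialE i (partialE i f) E
      + η / N * ∑ i, ∑ l ∈ Finset.univ.erase i, 1 / (E i - E l) * partialE i f E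
      - 2 * ∑ k, E k * partialE k f E
      - (N : ℝ) * (N + 1) / 2 * f E

/-- The exchange operator `K_{ij}`, swapping the coordinates `E_i` and `E_j`. -/
def exchange {N : ℕ} (i j : Fin N) (f : (Fin N → ℝ) → ℝ) : (Fin N → ℝ) → ℝ :=
  fun E => f (E ∘ Equiv.swap i j)

/-- The Dunkl operator
`D_i^E = ∂_i + (1/2) ∑_{j ≠ i} (E_i - E_j)⁻¹ (1 - K_{ij})`, with `β = 1/2`. -/
def dunklE {N : ℕ} (i : Fin N) (f : (Fin N → ℝ) → ℝ) : (Fin N → ℝ) → ℝ :=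
  fun E => partialE i f E
    + 1 / 2 * ∑ j ∈ Finset.univ.erase i, 1 / (E i - E j) * (f E - exchange i j f E)

/-- The factor in the change of variables `y_i = √(N/η) E_i`. -/
def scale (N : ℕ) (η : ℝ) : ℝ := √((N : ℝ) / η)

/-- The rescaled coordinate `y_i = √(N/η) E_i`. -/
def y (N : ℕ) (η : ℝ) (i : Fin N) (E : Fin N → ℝ) : ℝ := scale N η * E i

/-- The Dunkl operator `D_i` in the variables `y`, related to `D_i^E` by
`D_i^E = √(N/η) D_i`. -/
def dunklY (N : ℕ) (η : ℝ) (i : Fin N) (f : (Fin N → ℝ) → ℝ) : (Fin N → ℝ) → ℝ :=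
  fun E => (scale N η)⁻¹ * dunklE i f E

/-- The annihilation operator `a_i = (y_i + D_i) / √2`. -/
def annihilate (N : ℕ) (η : ℝ) (i : Fin N) (f : (Fin N → ℝ) → ℝ) : (Fin N → ℝ) → ℝ :=
  fun E => 1 / √2 * (y N η i E * f E + dunklY N η i f E)

/-- The creation operator `a_i† = (y_i - D_i) / √2`. -/
def create (N : ℕ) (η : ℝ) (i : Fin N) (f : (Fin N → ℝ) → ℝ) : (Fin N → ℝ) → ℝ :=
  fun E => 1 / √2 * (y N η i E * f E - dunklY N η i f E)

/-- The Virasoro generator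
`L_{-m} = ∑_i (α (a_i†)^{m+1} a_i + (1 - α) a_i (a_i†)^{m+1})`, for integers `m ≥ -1`. -/
def virasoro (N : ℕ) (η α : ℝ) (m : ℤ) (f : (Fin N → ℝ) → ℝ) : (Fin N → ℝ) → ℝ :=
  fun E => ∑ i : Fin N,
    (α * (create N η i)^[(m + 1).toNat] (annihilate N η i f) E
      + (1 - α) * annihilate N η i ((create N η i)^[(m + 1).toNat] f) E)

/-- The conjugated generator
`L̃_{-m} = exp (½ ∑ y_j²) L_{-m} exp (-½ ∑ y_j²)`, for integers `m ≥ -1`. -/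
def virasoroConj (N : ℕ) (η α : ℝ) (m : ℤ) (f : (Fin N → ℝ) → ℝ) : (Fin N → ℝ) → ℝ :=
  fun E => Real.exp (1 / 2 * ∑ j, y N η j E ^ 2)
    * virasoro N η α m (fun E' => Real.exp (-(1 / 2 * ∑ j, y N η j E' ^ 2)) * f E') E

end SymPhi4

end

/-! The proof joins an algebraic fact about Dunkl operators to two Ward identities of the matrix
integral.

Algebra. Let `H = ½ ∑ (y_i² - D_i²)`. The relations of the Dunkl algebra give `[H, y_i] = -D_i` and
`[H, D_i] = -y_i`, so `a_i†` and `a_i` have weights `1` and `-1` under `ad H`. Each term of `L_{-m}`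
has `m + 1` creation operators and one annihilation operator, in either order, whence `[H, L_{-m}] =
m L_{-m}` (`calogero_commutator_virasoroOp`). The deep input is that the Dunkl operators commute
(`dunklOp_comm`).

Link. On symmetric functions `L_SD` equals `∑ D_i² - 2 ∑ y_i D_i - N(N+1)/2`
(`IsSymmetric.lsdOp_apply`). Conjugation by `exp (½ ∑ y_j²)` shifts `D_i` to `D_i + y_i` and
produces `-2H + ∑ [D_i, y_i] - N(N+1)/2`; on symmetric functions the last two terms cancel. If `Z`
is symmetric and `L_SD Z = 0`, then `h = exp (-½ ∑ y_j²) Z` satisfies `H h = 0`, so `H L_{-m} h = m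
L_{-m} h`. As `L_{-m} h` is again symmetric, conjugating back gives the eigenvalue `-2m`
(`LSD_virasoroConj`).

Matrix integral. Differentiation in `E_i` inserts `-N (Φ²)_{ii}`. Scaling of `Φ` expresses `N(N+1)/2
· Z` through the expectations of `Tr EΦ²` and `Tr Φ⁴ = ∑ (Φ²)_{ij}²` (`expect_scaling`). The terms
`i = j` are second derivatives of `Z`; for `i ≠ j`, rotation in the `(i, j)`-plane turns them into
differences of first derivatives over `E_i - E_j` (`expect_ward`). Together this is `L_SD Z = 0`
(`LSD_Z`). Convergence and smoothness follow from `(Tr Φ²)² ≤ N Tr Φ⁴`.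

The operators are realised as endomorphisms of the functions that are smooth at points with distinct
coordinates and zero elsewhere, so that the algebra takes place in an honest ring. -/

noncomputable section

namespace SymPhi4

/-! ### Commutators with the Calogero Hamiltonian in an abstract Dunkl algebra -/

section CalogeroAlgebra

variable {ι R : Type*} [Fintype ι] [DecidableEq ι] [Ring R] [Algebra ℝ R]

/-- The commutator `[D_i, y_j]` in the Dunkl algebra with `β = 1/2`. -/
def dunklBracket (K : ι → ι → R) (i j : ι) : R :=
  if i = j then 1 + (1 / 2 : ℝ) • ∑ k ∈ Finset.univ.erase i, K i k else -((1 / 2 : ℝ) • K i j)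

/-- The exchange relations turn `K i j * x j + x j * K i j` into `x i * K i j + K i j * x i`, so the
off-diagonal brackets cancel the exchange part of the diagonal one. This is why `H` obeys the
commutators of a free oscillator; it is applied with `x = D` and with `x = y`. -/
theorem sum_dunklBracket_anticommutator (K : ι → ι → R) (x : ι → R)
    (h₁ : ∀ i j, K i j * x i = x j * K i j) (h₂ : ∀ i j, K i j * x j = x i * K i j) (i : ι) :
    ∑ j, (dunklBracket K i j * x j + x j * dunklBracket K i j) = 2 * x i := by
  rw [← Finset.add_sum_erase _ _ (Finset.mem_univ i)]
  have h : ∑ j ∈ Finset.univ.erase i, (dunklBracket K i j * x j + x j * dunklBracket K i j) =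
      -((1 / 2 : ℝ) • ∑ k ∈ Finset.univ.erase i, (K i k * x i + x i * K i k)) := by
    rw [Finset.smul_sum, ← Finset.sum_neg_distrib]
    refine Finset.sum_congr rfl fun j hj => ?_
    rw [dunklBracket, if_neg (Finset.ne_of_mem_erase hj).symm, h₁, neg_mul, mul_neg,
      smul_mul_assoc, mul_smul_comm, h₂, smul_add]
    abel
  rw [h, dunklBracket, if_pos rfl, Finset.sum_add_distrib, ← Finset.sum_mul, ← Finset.mul_sum,
    add_mul, mul_add, smul_mul_assoc, mul_smul_comm, smul_add]
  simp only [one_mul, mul_one, two_mul]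
  abel

/-- The Calogero Hamiltonian `½ ∑ (y_i² - D_i²)`. -/
def calogero (y D : ι → R) : R := (1 / 2 : ℝ) • ∑ i, (y i * y i - D i * D i)

omit [DecidableEq ι] [Algebra ℝ R] in
theorem sum_sq_commutator (u : ι → R) (v : R) :
    (∑ j, u j * u j) * v - v * ∑ j, u j * u j =
      ∑ j, ((u j * v - v * u j) * u j + u j * (u j * v - v * u j)) := by
  rw [Finset.sum_mul, Finset.mul_sum, ← Finset.sum_sub_distrib]
  refine Finset.sum_congr rfl fun j _ => ?_
  noncomm_ring

variable {y D : ι → R} {K : ι → ι → R}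

theorem calogero_commutator_y (hy : ∀ i j, y i * y j = y j * y i)
    (hDy : ∀ i j, D i * y j - y j * D i = dunklBracket K i j) (hK : ∀ i j, K i j = K j i)
    (h₁ : ∀ i j, K i j * D i = D j * K i j) (h₂ : ∀ i j, K i j * D j = D i * K i j) (i : ι) :
    calogero y D * y i - y i * calogero y D = -D i := by
  have hsymm : ∀ i j, dunklBracket K i j = dunklBracket K j i := by
    intro i j
    by_cases h : i = j
    · rw [h]
    · rw [dunklBracket, dunklBracket, if_neg h, if_neg (Ne.symm h), hK]
  have e₁ : (∑ j, y j * y j) * y i - y i * ∑ j, y j * y j = 0 := by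
    rw [sum_sq_commutator]
    exact Finset.sum_eq_zero fun j _ => by rw [hy j i]; simp
  have e₂ : (∑ j, D j * D j) * y i - y i * ∑ j, D j * D j = 2 * D i := by
    rw [sum_sq_commutator, ← sum_dunklBracket_anticommutator K D h₁ h₂ i]
    exact Finset.sum_congr rfl fun j _ => by rw [hDy, hsymm]
  have e : calogero y D * y i - y i * calogero y D =
      (1 / 2 : ℝ) • (((∑ j, y j * y j) * y i - y i * ∑ j, y j * y j) -
        ((∑ j, D j * D j) * y i - y i * ∑ j, D j * D j)) := by
    rw [calogero, Finset.sum_sub_distrib, smul_mul_assoc, mul_smul_comm, ← smul_sub]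
    congr 1
    noncomm_ring
  rw [e, e₁, e₂, zero_sub, two_mul, ← two_smul ℝ (D i), smul_neg, smul_smul]
  norm_num

theorem calogero_commutator_D (hD : ∀ i j, D i * D j = D j * D i)
    (hDy : ∀ i j, D i * y j - y j * D i = dunklBracket K i j)
    (h₁ : ∀ i j, K i j * y i = y j * K i j) (h₂ : ∀ i j, K i j * y j = y i * K i j) (i : ι) :
    calogero y D * D i - D i * calogero y D = -y i := by
  have e₁ : (∑ j, D j * D j) * D i - D i * ∑ j, D j * D j = 0 := by
    rw [sum_sq_commutator]
    exact Finset.sum_eq_zero fun j _ => by rw [hD j i]; simp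
  have e₂ : (∑ j, y j * y j) * D i - D i * ∑ j, y j * y j = -(2 * y i) := by
    rw [sum_sq_commutator, ← sum_dunklBracket_anticommutator K y h₁ h₂ i,
      ← Finset.sum_neg_distrib]
    refine Finset.sum_congr rfl fun j _ => ?_
    rw [← neg_sub (D i * y j), hDy]
    noncomm_ring
  have e : calogero y D * D i - D i * calogero y D =
      (1 / 2 : ℝ) • (((∑ j, y j * y j) * D i - D i * ∑ j, y j * y j) -
        ((∑ j, D j * D j) * D i - D i * ∑ j, D j * D j)) := by
    rw [calogero, Finset.sum_sub_distrib, smul_mul_assoc, mul_smul_comm, ← smul_sub]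
    congr 1
    noncomm_ring
  rw [e, e₁, e₂, sub_zero, two_mul, ← two_smul ℝ (y i), smul_neg, smul_smul]
  norm_num

theorem commutator_pow {H a : R} {c : ℝ} (h : H * a - a * H = c • a) (n : ℕ) :
    H * a ^ n - a ^ n * H = (n * c) • a ^ n := by
  induction n with
  | zero => simp
  | succ n ih =>
    have e : H * a ^ (n + 1) - a ^ (n + 1) * H =
        (H * a ^ n - a ^ n * H) * a + a ^ n * (H * a - a * H) := by
      rw [pow_succ]; noncomm_ring
    rw [e, ih, h, smul_mul_assoc, mul_smul_comm, ← pow_succ, ← add_smul]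
    push_cast
    ring_nf

theorem commutator_mul {H a b : R} {c d : ℝ} (ha : H * a - a * H = c • a)
    (hb : H * b - b * H = d • b) : H * (a * b) - a * b * H = (c + d) • (a * b) := by
  have e : H * (a * b) - a * b * H = (H * a - a * H) * b + a * (H * b - b * H) := by
    noncomm_ring
  rw [e, ha, hb, smul_mul_assoc, mul_smul_comm, ← add_smul]

/-- The generator `∑ (α (a_i†)ⁿ a_i + (1 - α) a_i (a_i†)ⁿ)`. -/
def virasoroOp (y D : ι → R) (α : ℝ) (n : ℕ) : R :=
  ∑ i, (α • (((1 / √2 : ℝ) • (y i - D i)) ^ n * ((1 / √2 : ℝ) • (y i + D i))) +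
    (1 - α) • (((1 / √2 : ℝ) • (y i + D i)) * ((1 / √2 : ℝ) • (y i - D i)) ^ n))

-- Since `ad H` is a derivation, weights add: `n` creation operators and one annihilation operator
-- give `n - 1` in both orderings, so `α` plays no role.
omit [DecidableEq ι] in
theorem calogero_commutator_virasoroOp
    (hy : ∀ i, calogero y D * y i - y i * calogero y D = -D i)
    (hD : ∀ i, calogero y D * D i - D i * calogero y D = -y i) (α : ℝ) (n : ℕ) :
    calogero y D * virasoroOp y D α n - virasoroOp y D α n * calogero y D =
      ((n : ℝ) - 1) • virasoroOp y D α n := by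
  have hc (i : ι) : calogero y D * ((1 / √2 : ℝ) • (y i - D i)) -
      ((1 / √2 : ℝ) • (y i - D i)) * calogero y D = (1 : ℝ) • ((1 / √2 : ℝ) • (y i - D i)) := by
    rw [mul_smul_comm, smul_mul_assoc, ← smul_sub, mul_sub, sub_mul, sub_sub_sub_comm, hy, hD,
      one_smul]
    congr 1
    abel
  have ha (i : ι) : calogero y D * ((1 / √2 : ℝ) • (y i + D i)) -
      ((1 / √2 : ℝ) • (y i + D i)) * calogero y D =
        (-1 : ℝ) • ((1 / √2 : ℝ) • (y i + D i)) := by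
    rw [mul_smul_comm, smul_mul_assoc, ← smul_sub, mul_add, add_mul, add_sub_add_comm, hy, hD,
      neg_one_smul, ← smul_neg]
    congr 1
    abel
  rw [virasoroOp, Finset.mul_sum, Finset.sum_mul, ← Finset.sum_sub_distrib, Finset.smul_sum]
  refine Finset.sum_congr rfl fun i _ => ?_
  have h₁ := commutator_mul (commutator_pow (hc i) n) (ha i)
  have h₂ := commutator_mul (ha i) (commutator_pow (hc i) n)
  rw [mul_add, add_mul, add_sub_add_comm, mul_smul_comm α, smul_mul_assoc α, ← smul_sub α, h₁,
    mul_smul_comm (1 - α), smul_mul_assoc (1 - α), ← smul_sub (1 - α), h₂,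
    smul_add ((n : ℝ) - 1), smul_smul α, smul_smul (1 - α), smul_smul _ α, smul_smul _ (1 - α),
    show α * (n * 1 + -1) = (n - 1) * α by ring,
    show (1 - α) * (-1 + n * 1) = (n - 1) * (1 - α) by ring]

theorem _root_.SemiconjBy.smul_right_real {u a b : R} (h : SemiconjBy u a b) (c : ℝ) :
    SemiconjBy u (c • a) (c • b) := by
  rw [SemiconjBy, mul_smul_comm, smul_mul_assoc, h.eq]

-- Conjugation by `u` only relabels the summands. Hence the generator preserves symmetric functions,
-- the only ones on which the Schwinger-Dyson operator takes its Dunkl form.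
omit [DecidableEq ι] in
theorem commute_virasoroOp {u : R} {σ : Equiv.Perm ι} (hy : ∀ i, SemiconjBy u (y i) (y (σ i)))
    (hD : ∀ i, SemiconjBy u (D i) (D (σ i))) (α : ℝ) (n : ℕ) :
    Commute u (virasoroOp y D α n) := by
  have hc (i : ι) := ((hy i).sub_right (hD i)).smul_right_real (1 / √2)
  have ha (i : ι) := ((hy i).add_right (hD i)).smul_right_real (1 / √2)
  rw [virasoroOp, Commute, SemiconjBy, Finset.mul_sum, Finset.sum_mul]
  conv_rhs => rw [← Equiv.sum_comp σ]
  refine Finset.sum_congr rfl fun i _ => ?_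
  exact (((((hc i).pow_right n).mul_right (ha i)).smul_right_real α).add_right
    (((ha i).mul_right ((hc i).pow_right n)).smul_right_real (1 - α))).eq

end CalogeroAlgebra

/-! ### Operators on functions smooth away from coinciding coordinates -/

section

variable {N : ℕ}

theorem isOpen_distinctPoints (N : ℕ) : IsOpen (distinctPoints N) := by
  have h : distinctPoints N = ⋂ i : Fin N, ⋂ j : Fin N, {E | i ≠ j → E i ≠ E j} := by
    ext E
    simp only [distinctPoints, Set.mem_ofPred_eq, Set.mem_iInter, Function.Injective]
    exact forall₂_congr fun i j => ⟨fun h hij hE => hij (h hE), fun h hE => by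
      by_contra hij; exact h hij hE⟩
  rw [h]
  refine isOpen_iInter_of_finite fun i => isOpen_iInter_of_finite fun j => ?_
  by_cases hij : i = j
  · simp [hij]
  · simpa [hij] using isOpen_ne_fun (continuous_apply i) (continuous_apply j)

theorem comp_perm_mem_distinctPoints (σ : Equiv.Perm (Fin N)) {E : Fin N → ℝ} :
    E ∘ σ ∈ distinctPoints N ↔ E ∈ distinctPoints N :=
  σ.injective_comp E

/-- The space of functions that are smooth on the set of points with pairwise distinct
coordinates and vanish elsewhere. -/
def smoothDistinct (N : ℕ) : Submodule ℝ ((Fin N → ℝ) → ℝ) where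
  carrier := {f | ContDiffOn ℝ ∞ f (distinctPoints N) ∧ ∀ E ∉ distinctPoints N, f E = 0}
  add_mem' hf hg := ⟨hf.1.add hg.1, fun E hE => by simp [hf.2 E hE, hg.2 E hE]⟩
  zero_mem' := ⟨contDiffOn_const, fun _ _ => rfl⟩
  smul_mem' c f hf := ⟨hf.1.const_smul c, fun E hE => by simp [hf.2 E hE]⟩

/-- The type of functions that are smooth on the set of points with pairwise distinct coordinates
and vanish elsewhere. -/
def SmoothDistinct (N : ℕ) : Type := smoothDistinct N

instance : AddCommGroup (SmoothDistinct N) := inferInstanceAs (AddCommGroup (smoothDistinct N))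

instance : Module ℝ (SmoothDistinct N) := inferInstanceAs (Module ℝ (smoothDistinct N))

namespace SmoothDistinct

instance : CoeFun (SmoothDistinct N) fun _ => (Fin N → ℝ) → ℝ := ⟨fun f => f.1⟩

theorem contDiffOn (f : SmoothDistinct N) : ContDiffOn ℝ ∞ f (distinctPoints N) := f.2.1

theorem eq_zero (f : SmoothDistinct N) {E : Fin N → ℝ} (hE : E ∉ distinctPoints N) : f E = 0 :=
  f.2.2 E hE

theorem ext_on {f g : SmoothDistinct N} (h : ∀ E ∈ distinctPoints N, f E = g E) : f = g := by
  refine Subtype.ext (funext fun E => ?_)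
  by_cases hE : E ∈ distinctPoints N
  · exact h E hE
  · rw [f.eq_zero hE, g.eq_zero hE]

@[simp] theorem coe_add_apply (f g : SmoothDistinct N) (E) : (f + g) E = f E + g E := rfl
@[simp] theorem coe_sub_apply (f g : SmoothDistinct N) (E) : (f - g) E = f E - g E := rfl
@[simp] theorem coe_neg_apply (f : SmoothDistinct N) (E) : (-f) E = -f E := rfl
@[simp] theorem coe_zero_apply (E) : (0 : SmoothDistinct N) E = 0 := rfl
@[simp] theorem coe_smul_apply (c : ℝ) (f : SmoothDistinct N) (E) : (c • f) E = c * f E := rfl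
@[simp] theorem coe_sum_apply {ι : Type*} (s : Finset ι) (f : ι → SmoothDistinct N) (E) :
    (∑ i ∈ s, f i) E = ∑ i ∈ s, f i E := by
  induction s using Finset.cons_induction with
  | empty => rfl
  | cons a s ha ih => rw [Finset.sum_cons, Finset.sum_cons, coe_add_apply, ih]

theorem differentiableAt (f : SmoothDistinct N) {E : Fin N → ℝ} (hE : E ∈ distinctPoints N) :
    DifferentiableAt ℝ f E :=
  (f.contDiffOn.differentiableOn (by simp)).differentiableAt
    ((isOpen_distinctPoints N).mem_nhds hE)

/-- Restriction to the points with pairwise distinct coordinates. -/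
def restrict (f : (Fin N → ℝ) → ℝ) (hf : ContDiffOn ℝ ∞ f (distinctPoints N)) :
    SmoothDistinct N :=
  ⟨(distinctPoints N).indicator f, hf.congr fun _ hE => Set.indicator_of_mem hE _,
    fun _ hE => Set.indicator_of_notMem hE _⟩

theorem restrict_apply {f : (Fin N → ℝ) → ℝ} (hf : ContDiffOn ℝ ∞ f (distinctPoints N))
    {E : Fin N → ℝ} (hE : E ∈ distinctPoints N) : restrict f hf E = f E :=
  Set.indicator_of_mem hE _

end SmoothDistinct

open SmoothDistinct

theorem contDiffOn_partialE {f : (Fin N → ℝ) → ℝ} (hf : ContDiffOn ℝ ∞ f (distinctPoints N))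
    (i : Fin N) : ContDiffOn ℝ ∞ (partialE i f) (distinctPoints N) :=
  (hf.fderiv_of_isOpen (isOpen_distinctPoints N) (by simp)).clm_apply contDiffOn_const

theorem partialE_congr {f g : (Fin N → ℝ) → ℝ} (h : Set.EqOn f g (distinctPoints N))
    {E : Fin N → ℝ} (hE : E ∈ distinctPoints N) (i : Fin N) :
    partialE i f E = partialE i g E := by
  rw [partialE, partialE,
    (h.eventuallyEq_of_mem ((isOpen_distinctPoints N).mem_nhds hE)).fderiv_eq]

/-- The partial derivative as an operator on smooth functions. -/
def partialOp (i : Fin N) : Module.End ℝ (SmoothDistinct N) where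
  toFun f := restrict (partialE i f) (contDiffOn_partialE f.contDiffOn i)
  map_add' f g := ext_on fun E hE => by
    rw [coe_add_apply, restrict_apply _ hE, restrict_apply _ hE, restrict_apply _ hE, partialE,
      partialE, partialE, ← add_apply,
      ← fderiv_add (f.differentiableAt hE) (g.differentiableAt hE)]
    rfl
  map_smul' c f := ext_on fun E hE => by
    rw [RingHom.id_apply, coe_smul_apply, restrict_apply _ hE, restrict_apply _ hE, partialE,
      partialE, ← smul_eq_mul, ← smul_apply,
      ← fderiv_const_smul (f.differentiableAt hE)]
    rfl

theorem partialOp_apply (i : Fin N) (f : SmoothDistinct N) {E : Fin N → ℝ}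
    (hE : E ∈ distinctPoints N) : partialOp i f E = partialE i f E :=
  restrict_apply (contDiffOn_partialE f.contDiffOn i) hE

/-- Multiplication by a smooth function. -/
def mulOp (r : (Fin N → ℝ) → ℝ) (hr : ContDiffOn ℝ ∞ r (distinctPoints N)) :
    Module.End ℝ (SmoothDistinct N) where
  toFun f := ⟨fun E => r E * f E, hr.mul f.contDiffOn, fun E hE =>
    (congrArg (r E * ·) (f.eq_zero hE)).trans (mul_zero _)⟩
  map_add' _ _ := Subtype.ext (funext fun _ => mul_add _ _ _)
  map_smul' _ _ := Subtype.ext (funext fun _ => mul_left_comm _ _ _)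

@[simp] theorem mulOp_apply (r : (Fin N → ℝ) → ℝ) (hr) (f : SmoothDistinct N) (E) :
    mulOp r hr f E = r E * f E := rfl

/-- The action of a permutation of the coordinates. -/
def permOp (σ : Equiv.Perm (Fin N)) : Module.End ℝ (SmoothDistinct N) where
  toFun f := ⟨fun E => f (E ∘ σ),
    f.contDiffOn.comp (contDiff_pi.2 fun i => contDiff_apply ℝ ℝ (σ i)).contDiffOn
      fun _ hE => (comp_perm_mem_distinctPoints σ).2 hE,
    fun _ hE => f.eq_zero (mt (comp_perm_mem_distinctPoints σ).1 hE)⟩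
  map_add' _ _ := rfl
  map_smul' _ _ := rfl

@[simp] theorem permOp_apply (σ : Equiv.Perm (Fin N)) (f : SmoothDistinct N) (E) :
    permOp σ f E = f (E ∘ σ) := rfl

/-- The function `1 / (E_i - E_j)`. -/
def invDiff (i j : Fin N) (E : Fin N → ℝ) : ℝ := 1 / (E i - E j)

theorem contDiffOn_invDiff (i j : Fin N) : ContDiffOn ℝ ∞ (invDiff i j) (distinctPoints N) := by
  -- As `1 / 0 = 0`, the diagonal case is the zero function; sums over `j ≠ i` may therefore run
  -- over all `j`.
  by_cases hij : i = j
  · subst hij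
    have : invDiff i i = fun _ : Fin N → ℝ => (0 : ℝ) := by
      funext E; simp [invDiff]
    rw [this]
    exact contDiffOn_const
  · exact contDiffOn_const.div ((contDiff_apply ℝ ℝ i).sub (contDiff_apply ℝ ℝ j)).contDiffOn
      fun E hE => sub_ne_zero.2 fun h => hij (hE h)

/-- The divided difference `(E_i - E_j)⁻¹ (1 - K_{ij})`. -/
def divDiff (i j : Fin N) : Module.End ℝ (SmoothDistinct N) :=
  mulOp (invDiff i j) (contDiffOn_invDiff i j) * (1 - permOp (Equiv.swap i j))

theorem divDiff_apply (i j : Fin N) (f : SmoothDistinct N) (E) :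
    divDiff i j f E = invDiff i j E * (f E - f (E ∘ Equiv.swap i j)) := rfl

/-- The Dunkl operator on smooth functions. -/
def dunklOp (i : Fin N) : Module.End ℝ (SmoothDistinct N) :=
  partialOp i + (1 / 2 : ℝ) • ∑ j, divDiff i j

/-- Multiplication by a coordinate. -/
def coordOp (i : Fin N) : Module.End ℝ (SmoothDistinct N) :=
  mulOp (fun E => E i) (contDiff_apply ℝ ℝ i).contDiffOn

@[simp] theorem coordOp_apply (i : Fin N) (f : SmoothDistinct N) (E) :
    coordOp i f E = E i * f E := rfl

theorem divDiff_self (i : Fin N) : divDiff i i = 0 :=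
  LinearMap.ext fun f => ext_on fun E _ => by simp [divDiff_apply, invDiff]

theorem divDiff_swap (i j : Fin N) : divDiff j i = -divDiff i j :=
  LinearMap.ext fun f => ext_on fun E _ => by
    rw [LinearMap.neg_apply, coe_neg_apply, divDiff_apply, divDiff_apply, Equiv.swap_comm,
      invDiff, invDiff, ← neg_sub (E i) (E j), one_div_neg_eq_neg_one_div, neg_mul]

/-! ### Equivariance -/

theorem permOp_coordOp (σ : Equiv.Perm (Fin N)) (i : Fin N) :
    permOp σ * coordOp i = coordOp (σ i) * permOp σ := rfl

theorem comp_perm_single (σ : Equiv.Perm (Fin N)) (i : Fin N) :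
    (Pi.single (σ i) (1 : ℝ) : Fin N → ℝ) ∘ σ = Pi.single i 1 := by
  funext k
  simp [Pi.single_apply]

theorem partialE_comp_perm (σ : Equiv.Perm (Fin N)) (i : Fin N) {f : (Fin N → ℝ) → ℝ}
    {E : Fin N → ℝ} (hf : DifferentiableAt ℝ f (E ∘ σ)) :
    partialE (σ i) (fun E => f (E ∘ σ)) E = partialE i f (E ∘ σ) := by
  have h : HasFDerivAt (fun E : Fin N → ℝ => E ∘ σ)
      (ContinuousLinearMap.pi fun i => ContinuousLinearMap.proj (σ i)) E :=
    hasFDerivAt_pi.2 fun k => hasFDerivAt_apply (𝕜 := ℝ) (σ k) E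
  have h' := (hf.hasFDerivAt.comp E h).fderiv
  rw [partialE, partialE, ← comp_perm_single σ i]
  exact congrArg (fun L : (Fin N → ℝ) →L[ℝ] ℝ => L (Pi.single (σ i) 1)) h'

theorem permOp_partialOp (σ : Equiv.Perm (Fin N)) (i : Fin N) :
    permOp σ * partialOp i = partialOp (σ i) * permOp σ :=
  LinearMap.ext fun f => ext_on fun E hE => by
    have hE' := (comp_perm_mem_distinctPoints σ).2 hE
    rw [Module.End.mul_apply, Module.End.mul_apply, permOp_apply, partialOp_apply _ _ hE',
      partialOp_apply _ _ hE]
    exact (partialE_comp_perm σ i (f.differentiableAt hE')).symm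

theorem permOp_divDiff (σ : Equiv.Perm (Fin N)) (i j : Fin N) :
    permOp σ * divDiff i j = divDiff (σ i) (σ j) * permOp σ :=
  LinearMap.ext fun f => ext_on fun E _ => by
    have h : E ∘ σ ∘ Equiv.swap i j = E ∘ Equiv.swap (σ i) (σ j) ∘ σ := by
      rw [← Equiv.Perm.coe_mul, ← Equiv.Perm.coe_mul, Equiv.mul_swap_eq_swap_mul]
    rw [Module.End.mul_apply, Module.End.mul_apply, permOp_apply, divDiff_apply, divDiff_apply,
      permOp_apply, permOp_apply, Function.comp_assoc, Function.comp_assoc, h]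
    rfl

theorem permOp_dunklOp (σ : Equiv.Perm (Fin N)) (i : Fin N) :
    permOp σ * dunklOp i = dunklOp (σ i) * permOp σ := by
  rw [dunklOp, dunklOp, mul_add, add_mul, permOp_partialOp, mul_smul_comm, smul_mul_assoc,
    Finset.mul_sum, Finset.sum_mul]
  congr 2
  rw [← Equiv.sum_comp σ fun j => divDiff (σ i) j * permOp σ]
  exact Finset.sum_congr rfl fun j _ => permOp_divDiff σ i j

/-! ### Dunkl relations -/

theorem coordOp_comm (i j : Fin N) : coordOp i * coordOp j = coordOp j * coordOp i :=
  LinearMap.ext fun _ => ext_on fun _ _ => mul_left_comm _ _ _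

theorem partialE_mul {r f : (Fin N → ℝ) → ℝ} {E : Fin N → ℝ} (hr : DifferentiableAt ℝ r E)
    (hf : DifferentiableAt ℝ f E) (i : Fin N) :
    partialE i (fun E => r E * f E) E = r E * partialE i f E + partialE i r E * f E := by
  have := (hr.hasFDerivAt.mul hf.hasFDerivAt).fderiv
  rw [partialE]
  refine (congrArg (fun L : (Fin N → ℝ) →L[ℝ] ℝ => L (Pi.single i 1)) this).trans ?_
  simp [partialE, mul_comm]

theorem partialOp_mulOp (i : Fin N) {r : (Fin N → ℝ) → ℝ}
    (hr : ContDiffOn ℝ ∞ r (distinctPoints N)) :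
    partialOp i * mulOp r hr = mulOp r hr * partialOp i +
      mulOp (partialE i r) (contDiffOn_partialE hr i) :=
  LinearMap.ext fun f => ext_on fun E hE => by
    rw [Module.End.mul_apply, LinearMap.add_apply, Module.End.mul_apply, coe_add_apply,
      mulOp_apply, mulOp_apply, partialOp_apply _ _ hE, partialOp_apply _ _ hE]
    exact partialE_mul ((hr.differentiableOn (by simp)).differentiableAt
      ((isOpen_distinctPoints N).mem_nhds hE)) (f.differentiableAt hE) i

theorem partialE_coord (i j : Fin N) (E : Fin N → ℝ) :
    partialE i (fun E => E j) E = if i = j then 1 else 0 := by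
  rw [partialE, (hasFDerivAt_apply (𝕜 := ℝ) j E).fderiv]
  simp [Pi.single_apply, eq_comm]

theorem partialOp_coordOp (i j : Fin N) :
    partialOp i * coordOp j = coordOp j * partialOp i + if i = j then 1 else 0 := by
  rw [coordOp, partialOp_mulOp]
  congr 1
  refine LinearMap.ext fun f => ext_on fun E hE => ?_
  rw [mulOp_apply, partialE_coord]
  split_ifs <;> simp

/-- Only the exchange fails to commute with `E_k`, and only for `k ∈ {i, j}`; the discrepancy `±(E_i
- E_j)` cancels the denominator and leaves `±K_{ij}`. -/
theorem divDiff_coordOp (i j k : Fin N) :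
    divDiff i j * coordOp k - coordOp k * divDiff i j =
      (if k = i then 1 else 0) * (if i = j then 0 else permOp (Equiv.swap i j)) -
      (if k = j then 1 else 0) * (if i = j then 0 else permOp (Equiv.swap i j)) := by
  by_cases hij : i = j
  · subst hij
    simp [divDiff_self]
  refine LinearMap.ext fun f => ext_on fun E hE => ?_
  have h : E i - E j ≠ 0 := sub_ne_zero.2 fun h => hij (hE h)
  rw [LinearMap.sub_apply, Module.End.mul_apply, Module.End.mul_apply, coe_sub_apply,
    divDiff_apply, coordOp_apply, coordOp_apply, coordOp_apply, divDiff_apply, invDiff,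
    Function.comp_apply, if_neg hij]
  by_cases hki : k = i
  · subst hki
    rw [Equiv.swap_apply_left, if_pos rfl, if_neg hij]
    simp
    field_simp
    ring
  by_cases hkj : k = j
  · subst hkj
    rw [Equiv.swap_apply_right, if_pos rfl, if_neg hki]
    simp
    field_simp
    ring
  rw [Equiv.swap_apply_of_ne_of_ne hki hkj, if_neg hki, if_neg hkj]
  simp
  ring

theorem dunklOp_coordOp (i j : Fin N) :
    dunklOp i * coordOp j - coordOp j * dunklOp i =
      dunklBracket (fun i j => permOp (Equiv.swap i j)) i j := by
  have h : dunklOp i * coordOp j - coordOp j * dunklOp i =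
      (if i = j then 1 else 0) +
        (1 / 2 : ℝ) • ∑ k, (divDiff i k * coordOp j - coordOp j * divDiff i k) := by
    rw [dunklOp, add_mul, mul_add, partialOp_coordOp, smul_mul_assoc, mul_smul_comm,
      Finset.sum_mul, Finset.mul_sum, Finset.sum_sub_distrib (s := Finset.univ), smul_sub]
    abel
  rw [h, dunklBracket]
  simp only [divDiff_coordOp]
  by_cases hij : i = j
  · subst hij
    rw [if_pos rfl, if_pos rfl, ← Finset.add_sum_erase _ _ (Finset.mem_univ i)]
    rw [if_pos rfl, if_pos rfl, mul_zero, sub_zero, zero_add]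
    congr 2
    refine Finset.sum_congr rfl fun k hk => ?_
    simp [(Finset.ne_of_mem_erase hk).symm]
  · rw [if_neg hij, if_neg hij, zero_add, ← smul_neg (1 / 2 : ℝ)]
    congr 1
    rw [Finset.sum_eq_single j]
    · simp [hij, Ne.symm hij]
    · intro k _ hk
      simp [Ne.symm hij, Ne.symm hk]
    · simp

end

/-! ### Commutativity of the Dunkl operators -/

section

open SmoothDistinct

variable {N : ℕ}

theorem partialE_partialE {f : (Fin N → ℝ) → ℝ} {E : Fin N → ℝ}
    (hf : DifferentiableAt ℝ (fderiv ℝ f) E) (i j : Fin N) :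
    partialE i (partialE j f) E = fderiv ℝ (fderiv ℝ f) E (Pi.single i 1) (Pi.single j 1) := by
  have h := (hf.hasFDerivAt.clm_apply (hasFDerivAt_const (Pi.single j (1 : ℝ)) E)).fderiv
  refine (congrArg (fun L : (Fin N → ℝ) →L[ℝ] ℝ => L (Pi.single i 1)) h).trans ?_
  simp

theorem partialOp_comm (i j : Fin N) :
    partialOp i * partialOp j = partialOp j * partialOp i :=
  LinearMap.ext fun f => ext_on fun E hE => by
    have h : ContDiffAt ℝ ∞ f E :=
      f.contDiffOn.contDiffAt ((isOpen_distinctPoints N).mem_nhds hE)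
    have hd : DifferentiableAt ℝ (fderiv ℝ f.1) E :=
      (h.fderiv_right (m := ∞) (by simp)).differentiableAt (by simp)
    have key (i j : Fin N) : (partialOp i * partialOp j) f E = partialE i (partialE j f) E := by
      rw [Module.End.mul_apply, partialOp_apply _ _ hE]
      exact partialE_congr (fun E' hE' => partialOp_apply j f hE') hE i
    rw [key, key, partialE_partialE hd, partialE_partialE hd]
    exact (h.isSymmSndFDerivAt (by
      rw [minSmoothness_of_isRCLikeNormedField]
      exact WithTop.coe_le_coe.2 (le_top : (2 : ℕ∞) ≤ ⊤))).eq _ _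

theorem partialE_invDiff {i j : Fin N} (k : Fin N) {E : Fin N → ℝ} (h : E i ≠ E j) :
    partialE k (invDiff i j) E =
      -((if k = i then 1 else 0) - (if k = j then 1 else 0)) / (E i - E j) ^ 2 := by
  have h₁ : HasFDerivAt (fun E : Fin N → ℝ => E i - E j)
      (ContinuousLinearMap.proj i - ContinuousLinearMap.proj j : (Fin N → ℝ) →L[ℝ] ℝ) E :=
    (hasFDerivAt_apply (𝕜 := ℝ) i E).sub (hasFDerivAt_apply (𝕜 := ℝ) j E)
  have h₂ := ((hasDerivAt_inv (sub_ne_zero.2 h)).comp_hasFDerivAt E h₁).fderiv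
  have h₃ : invDiff i j = Inv.inv ∘ fun E : Fin N → ℝ => E i - E j := by
    funext E; simp [invDiff]
  rw [partialE, h₃, h₂]
  simp [Pi.single_apply, eq_comm]
  ring

theorem partialOp_divDiff_of_ne {i j k : Fin N} (hi : k ≠ i) (hj : k ≠ j) :
    partialOp k * divDiff i j = divDiff i j * partialOp k := by
  by_cases hij : i = j
  · rw [hij, divDiff_self, mul_zero, zero_mul]
  have h₀ : mulOp (partialE k (invDiff i j)) (contDiffOn_partialE (contDiffOn_invDiff i j) k) =
      0 := LinearMap.ext fun f => ext_on fun E hE => by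
    rw [mulOp_apply, partialE_invDiff k fun h => hij (hE h), if_neg hi, if_neg hj]
    simp
  have h₁ := permOp_partialOp (Equiv.swap i j) k
  rw [Equiv.swap_apply_of_ne_of_ne hi hj] at h₁
  rw [divDiff, ← mul_assoc, partialOp_mulOp, h₀, add_zero, mul_assoc, mul_assoc, mul_sub,
    sub_mul, h₁, one_mul, mul_one]

/-- The operator `∂_i + ∂_j` generates simultaneous translation of both coordinates, which fixes
`E_i - E_j` and commutes with the exchange. -/
theorem partialOp_add_divDiff {i j : Fin N} (hij : i ≠ j) :
    (partialOp i + partialOp j) * divDiff i j = divDiff i j * (partialOp i + partialOp j) := by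
  have h₀ : mulOp (partialE i (invDiff i j)) (contDiffOn_partialE (contDiffOn_invDiff i j) i) +
      mulOp (partialE j (invDiff i j)) (contDiffOn_partialE (contDiffOn_invDiff i j) j) = 0 :=
    LinearMap.ext fun f => ext_on fun E hE => by
      rw [LinearMap.add_apply, coe_add_apply, mulOp_apply, mulOp_apply,
        partialE_invDiff i fun h => hij (hE h), partialE_invDiff j fun h => hij (hE h),
        if_pos rfl, if_neg hij, if_pos rfl, if_neg hij.symm]
      simp
      ring
  have h₁ := permOp_partialOp (Equiv.swap i j) i
  have h₂ := permOp_partialOp (Equiv.swap i j) j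
  rw [Equiv.swap_apply_left] at h₁
  rw [Equiv.swap_apply_right] at h₂
  have h₃ : (partialOp i + partialOp j) * permOp (Equiv.swap i j) =
      permOp (Equiv.swap i j) * (partialOp i + partialOp j) := by
    rw [add_mul, mul_add, h₁, h₂, add_comm]
  have h₄ : (partialOp i + partialOp j) * mulOp (invDiff i j) (contDiffOn_invDiff i j) =
      mulOp (invDiff i j) (contDiffOn_invDiff i j) * (partialOp i + partialOp j) := by
    rw [add_mul, mul_add, partialOp_mulOp, partialOp_mulOp, add_add_add_comm, h₀, add_zero]
  rw [divDiff, ← mul_assoc, h₄, mul_assoc, mul_assoc, mul_sub, sub_mul, h₃, one_mul, mul_one]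

theorem divDiff_comm_of_disjoint {i j k l : Fin N} (hij : i ≠ j) (hkl : k ≠ l) (hil : i ≠ l)
    (hkj : k ≠ j) : divDiff i k * divDiff j l = divDiff j l * divDiff i k := by
  have h : Equiv.swap i k * Equiv.swap j l = Equiv.swap j l * Equiv.swap i k := by
    rw [Equiv.mul_swap_eq_swap_mul, Equiv.swap_apply_of_ne_of_ne hij.symm hkj.symm,
      Equiv.swap_apply_of_ne_of_ne hil.symm hkl.symm]
  refine LinearMap.ext fun f => ext_on fun E _ => ?_
  simp only [Module.End.mul_apply, divDiff_apply, invDiff, Function.comp_apply,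
    Function.comp_assoc, ← Equiv.Perm.coe_mul, h, Equiv.swap_apply_of_ne_of_ne hij hil,
    Equiv.swap_apply_of_ne_of_ne hij.symm hkj.symm, Equiv.swap_apply_of_ne_of_ne hkj hkl,
    Equiv.swap_apply_of_ne_of_ne hil.symm hkl.symm]
  ring

/-- This is a classical Yang-Baxter type relation. The products of transpositions reduce to the two
3-cycles (`h₁` to `h₄`). The values of `f` along the orbit of `E` are then treated as independent
unknowns, whose coefficients vanish by partial fractions. -/
theorem divDiff_three_term {i j k : Fin N} (hij : i ≠ j) (hik : i ≠ k) (hjk : j ≠ k) :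
    (divDiff i k * divDiff j k - divDiff j k * divDiff i k) +
      (divDiff i k * divDiff j i - divDiff j i * divDiff i k) +
      (divDiff i j * divDiff j k - divDiff j k * divDiff i j) = 0 := by
  have h₁ : Equiv.swap i j * Equiv.swap j k = Equiv.swap i k * Equiv.swap i j := by
    rw [Equiv.mul_swap_eq_swap_mul, Equiv.swap_apply_right,
      Equiv.swap_apply_of_ne_of_ne hik.symm hjk.symm]
  have h₂ : Equiv.swap j k * Equiv.swap i k = Equiv.swap i j * Equiv.swap j k := by
    rw [Equiv.mul_swap_eq_swap_mul, Equiv.swap_apply_right,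
      Equiv.swap_apply_of_ne_of_ne hij hik]
  have h₃ : Equiv.swap i k * Equiv.swap j k = Equiv.swap j k * Equiv.swap i j := by
    rw [Equiv.mul_swap_eq_swap_mul (Equiv.swap j k), Equiv.swap_apply_left,
      Equiv.swap_apply_of_ne_of_ne hij hik]
  have h₄ : Equiv.swap i j * Equiv.swap i k = Equiv.swap j k * Equiv.swap i j := by
    rw [Equiv.mul_swap_eq_swap_mul, Equiv.swap_apply_left,
      Equiv.swap_apply_of_ne_of_ne hik.symm hjk.symm]
  rw [divDiff_swap i j]
  refine LinearMap.ext fun f => ext_on fun E hE => ?_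
  have n₁ : E i - E j ≠ 0 := sub_ne_zero.2 fun h => hij (hE h)
  have n₂ : E i - E k ≠ 0 := sub_ne_zero.2 fun h => hik (hE h)
  have n₃ : E j - E k ≠ 0 := sub_ne_zero.2 fun h => hjk (hE h)
  have n₁' : E j - E i ≠ 0 := sub_ne_zero.2 fun h => hij (hE h.symm)
  have n₂' : E k - E i ≠ 0 := sub_ne_zero.2 fun h => hik (hE h.symm)
  have n₃' : E k - E j ≠ 0 := sub_ne_zero.2 fun h => hjk (hE h.symm)
  simp only [LinearMap.add_apply, LinearMap.sub_apply, LinearMap.neg_apply, Module.End.mul_apply,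
    coe_add_apply, coe_sub_apply, coe_neg_apply, map_neg, divDiff_apply, invDiff,
    Function.comp_apply, Function.comp_assoc, ← Equiv.Perm.coe_mul, Equiv.swap_apply_left,
    Equiv.swap_apply_right, Equiv.swap_apply_of_ne_of_ne hij hik,
    Equiv.swap_apply_of_ne_of_ne hij.symm hjk, Equiv.swap_apply_of_ne_of_ne hik.symm hjk.symm,
    h₂, h₁, h₃, h₄, LinearMap.zero_apply, coe_zero_apply]
  generalize f (E ∘ ⇑(Equiv.swap i k * Equiv.swap i j)) = a
  generalize f (E ∘ ⇑(Equiv.swap j k * Equiv.swap i j)) = b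
  generalize f (E ∘ ⇑(Equiv.swap i j)) = c
  generalize f (E ∘ ⇑(Equiv.swap j k)) = d
  generalize f (E ∘ ⇑(Equiv.swap i k)) = e
  generalize f E = g
  generalize E i = x at *
  generalize E j = y at *
  generalize E k = z at *
  have e₁ : y - x = -(x - y) := by ring
  have e₃ : z - y = -(y - z) := by ring
  simp only [e₁, e₃]
  field_simp
  ring

theorem sum_divDiff_comm (i j : Fin N) :
    (∑ k, divDiff i k) * (∑ l, divDiff j l) = (∑ l, divDiff j l) * ∑ k, divDiff i k := by
  by_cases hij : i = j
  · rw [hij]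
  set c : Fin N → Fin N → Module.End ℝ (SmoothDistinct N) := fun k l =>
    divDiff i k * divDiff j l - divDiff j l * divDiff i k with hc
  have c₁ (l : Fin N) : c i l = 0 := by rw [hc]; simp [divDiff_self]
  have c₂ (k : Fin N) : c k j = 0 := by rw [hc]; simp [divDiff_self]
  have c₃ : c j i = 0 := by rw [hc]; simp [divDiff_swap i j]
  -- A commutator of divided differences survives only if the pairs `{i, k}` and `{j, l}` share an
  -- index, that is for `k = l`, `l = i` or `k = j`. By `c₁`, `c₂`, `c₃` the overlaps of these cases
  -- vanish, so nothing is counted twice; for each third index `k` the three survivors form the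
  -- three-term relation.
  have hsplit (k l : Fin N) : c k l =
      (if k = l then c k k else 0) + (if l = i then c k i else 0) +
        (if k = j then c j l else 0) := by
    by_cases hkl : k = l
    · subst hkl
      by_cases hk : k = i
      · subst hk
        simp [c₁, hij]
      · by_cases hk' : k = j
        · subst hk'
          simp [c₂, hk]
        · simp [hk, hk']
    · by_cases hl : l = i
      · subst hl
        by_cases hk : k = j
        · subst hk
          simp [c₃, hkl]
        · simp [hkl, hk]
      · by_cases hk : k = j
        · simp [hk, hl]
          rintro rfl
          exact c₂ _
        · have : c k l = 0 := sub_eq_zero.2 (divDiff_comm_of_disjoint hij hkl (Ne.symm hl) hk)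
          simp [hkl, hk, hl, this]
  have hsum : ∑ k, ∑ l, c k l = ∑ k, (c k k + c k i + c j k) := by
    rw [Finset.sum_congr rfl fun k _ => Finset.sum_congr rfl fun l _ => hsplit k l]
    simp only [Finset.sum_add_distrib, Finset.sum_ite_eq, Finset.sum_ite_eq',
      Finset.mem_univ, if_true]
    rw [Finset.sum_comm (f := fun k l => if k = j then c j l else 0)]
    simp
  have hzero : ∑ k, (c k k + c k i + c j k) = 0 := by
    refine Finset.sum_eq_zero fun k _ => ?_
    by_cases hki : k = i
    · subst hki
      rw [c₁, c₃, zero_add, zero_add]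
    by_cases hkj : k = j
    · subst hkj
      rw [c₂, c₃, zero_add, zero_add]
    exact divDiff_three_term hij (Ne.symm hki) (Ne.symm hkj)
  rw [← sub_eq_zero, Finset.sum_mul_sum, Finset.sum_mul_sum, Finset.sum_comm (s := Finset.univ)
    (f := fun l k => divDiff j l * divDiff i k), ← Finset.sum_sub_distrib]
  simp only [← Finset.sum_sub_distrib]
  exact hsum.trans hzero

theorem partialOp_sum_divDiff {i j : Fin N} (hij : i ≠ j) :
    partialOp i * (∑ l, divDiff j l) - (∑ l, divDiff j l) * partialOp i =
      partialOp i * divDiff j i - divDiff j i * partialOp i := by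
  rw [Finset.mul_sum, Finset.sum_mul, ← Finset.sum_sub_distrib]
  refine Finset.sum_eq_single i (fun l _ hl => ?_) (by simp)
  rw [partialOp_divDiff_of_ne hij hl.symm, sub_self]

/-- The commutator is expanded in powers of `β = 1/2`. Order zero is the symmetry of second
derivatives, order one is translation invariance of `divDiff i j`, and order two is
`sum_divDiff_comm`. -/
theorem dunklOp_comm (i j : Fin N) : dunklOp i * dunklOp j = dunklOp j * dunklOp i := by
  by_cases hij : i = j
  · rw [hij]
  have h₁ := partialOp_sum_divDiff hij
  have h₂ := partialOp_sum_divDiff (Ne.symm hij)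
  have h₃ := partialOp_add_divDiff hij
  have h₄ := sum_divDiff_comm i j
  rw [divDiff_swap i j] at h₁
  rw [add_mul, mul_add] at h₃
  have h₅ : dunklOp i * dunklOp j - dunklOp j * dunklOp i =
      (partialOp i * partialOp j - partialOp j * partialOp i) +
      (1 / 2 : ℝ) • ((partialOp i * (∑ l, divDiff j l) - (∑ l, divDiff j l) * partialOp i) -
        (partialOp j * (∑ l, divDiff i l) - (∑ l, divDiff i l) * partialOp j)) +
      ((1 / 2 : ℝ) * (1 / 2)) • ((∑ k, divDiff i k) * (∑ l, divDiff j l) -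
        (∑ l, divDiff j l) * ∑ k, divDiff i k) := by
    rw [dunklOp, dunklOp]
    simp only [mul_add, add_mul, mul_smul_comm, smul_mul_assoc, smul_sub, smul_add, smul_smul]
    abel
  have h₆ : partialOp i * -divDiff i j - -divDiff i j * partialOp i -
      (partialOp j * divDiff i j - divDiff i j * partialOp j) = 0 := by
    rw [← sub_eq_zero] at h₃
    rw [← neg_eq_zero, ← h₃]
    noncomm_ring
  rw [← sub_eq_zero, h₅, h₁, h₂, h₄, h₆, partialOp_comm i j, sub_self, sub_self, smul_zero,
    smul_zero, add_zero, add_zero]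

end

/-! ### Rescaled Dunkl operators and the Schwinger-Dyson operator -/

section

open SmoothDistinct

variable {N : ℕ} {η : ℝ}

/-- Multiplication by the rescaled coordinate `y_i`. -/
def yOp (N : ℕ) (η : ℝ) (i : Fin N) : Module.End ℝ (SmoothDistinct N) := scale N η • coordOp i

/-- The Dunkl operator in the rescaled coordinates. -/
def dunklYOp (N : ℕ) (η : ℝ) (i : Fin N) : Module.End ℝ (SmoothDistinct N) :=
  (scale N η)⁻¹ • dunklOp i

theorem scale_pos (hN : 1 ≤ N) (hη : 0 < η) : 0 < scale N η :=
  Real.sqrt_pos.2 (div_pos (by exact_mod_cast hN) hη)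

theorem scale_mul_self (hη : 0 < η) : scale N η * scale N η = N / η :=
  Real.mul_self_sqrt (by positivity)

theorem semiconjBy_yOp (σ : Equiv.Perm (Fin N)) (i : Fin N) :
    SemiconjBy (permOp σ) (yOp N η i) (yOp N η (σ i)) :=
  SemiconjBy.smul_right_real (permOp_coordOp σ i) _

theorem semiconjBy_dunklYOp (σ : Equiv.Perm (Fin N)) (i : Fin N) :
    SemiconjBy (permOp σ) (dunklYOp N η i) (dunklYOp N η (σ i)) :=
  SemiconjBy.smul_right_real (permOp_dunklOp σ i) _

theorem yOp_comm (i j : Fin N) : yOp N η i * yOp N η j = yOp N η j * yOp N η i := by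
  rw [yOp, yOp, smul_mul_smul_comm, smul_mul_smul_comm, coordOp_comm]

theorem dunklYOp_comm (i j : Fin N) :
    dunklYOp N η i * dunklYOp N η j = dunklYOp N η j * dunklYOp N η i := by
  rw [dunklYOp, dunklYOp, smul_mul_smul_comm, smul_mul_smul_comm, dunklOp_comm]

theorem dunklYOp_yOp (hN : 1 ≤ N) (hη : 0 < η) (i j : Fin N) :
    dunklYOp N η i * yOp N η j - yOp N η j * dunklYOp N η i =
      dunklBracket (fun i j => permOp (Equiv.swap i j)) i j := by
  have hs := (scale_pos hN hη).ne'
  rw [dunklYOp, yOp, smul_mul_smul_comm, smul_mul_smul_comm, inv_mul_cancel₀ hs,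
    mul_inv_cancel₀ hs, one_smul, one_smul, dunklOp_coordOp]

theorem calogero_commutator_virasoroOp_dunkl (hN : 1 ≤ N) (hη : 0 < η) (α : ℝ) (n : ℕ) :
    calogero (yOp N η) (dunklYOp N η) * virasoroOp (yOp N η) (dunklYOp N η) α n -
        virasoroOp (yOp N η) (dunklYOp N η) α n * calogero (yOp N η) (dunklYOp N η) =
      ((n : ℝ) - 1) • virasoroOp (yOp N η) (dunklYOp N η) α n := by
  refine calogero_commutator_virasoroOp
    (calogero_commutator_y yOp_comm (dunklYOp_yOp hN hη) (fun i j => ?_) (fun i j => ?_)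
      fun i j => ?_)
    (calogero_commutator_D dunklYOp_comm (dunklYOp_yOp hN hη) (fun i j => ?_) fun i j => ?_) α n
  · rw [Equiv.swap_comm]
  · simpa using (semiconjBy_dunklYOp (η := η) (Equiv.swap i j) i).eq
  · simpa using (semiconjBy_dunklYOp (η := η) (Equiv.swap i j) j).eq
  · simpa using (semiconjBy_yOp (η := η) (Equiv.swap i j) i).eq
  · simpa using (semiconjBy_yOp (η := η) (Equiv.swap i j) j).eq

/-! ### Conjugation by the Gaussian factor -/

theorem contDiffOn_gaussian (N : ℕ) (η c : ℝ) :
    ContDiffOn ℝ ∞ (fun E => Real.exp (c * ∑ j, y N η j E ^ 2)) (distinctPoints N) := by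
  unfold y
  exact ContDiff.contDiffOn (by fun_prop)

/-- Multiplication by `exp (c ∑ y_j²)`. -/
def gaussianOp (N : ℕ) (η c : ℝ) : Module.End ℝ (SmoothDistinct N) :=
  mulOp _ (contDiffOn_gaussian N η c)

theorem gaussianOp_apply (c : ℝ) (f : SmoothDistinct N) (E) :
    gaussianOp N η c f E = Real.exp (c * ∑ j, y N η j E ^ 2) * f E := rfl

theorem gaussianOp_mul_neg (c : ℝ) : gaussianOp N η c * gaussianOp N η (-c) = 1 :=
  LinearMap.ext fun f => ext_on fun E _ => by
    rw [Module.End.mul_apply, gaussianOp_apply, gaussianOp_apply, ← mul_assoc, ← Real.exp_add]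
    simp

theorem permOp_gaussianOp (σ : Equiv.Perm (Fin N)) (c : ℝ) :
    permOp σ * gaussianOp N η c = gaussianOp N η c * permOp σ :=
  LinearMap.ext fun f => ext_on fun E _ => by
    have h : ∑ j, y N η j (E ∘ σ) ^ 2 = ∑ j, y N η j E ^ 2 :=
      Equiv.sum_comp σ fun j => y N η j E ^ 2
    rw [Module.End.mul_apply, Module.End.mul_apply, permOp_apply, gaussianOp_apply,
      gaussianOp_apply, h, permOp_apply]

theorem partialE_gaussian (c : ℝ) (i : Fin N) (E : Fin N → ℝ) :
    partialE i (fun E => Real.exp (c * ∑ j, y N η j E ^ 2)) E =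
      2 * c * scale N η * y N η i E * Real.exp (c * ∑ j, y N η j E ^ 2) := by
  have h₁ (j : Fin N) : HasFDerivAt (fun E : Fin N → ℝ => y N η j E)
      (scale N η • ContinuousLinearMap.proj j : (Fin N → ℝ) →L[ℝ] ℝ) E :=
    (hasFDerivAt_apply (𝕜 := ℝ) j E).const_mul (scale N η)
  have h₂ := (((HasFDerivAt.fun_sum (u := Finset.univ) fun j _ =>
    (h₁ j).pow 2).const_mul c).exp).fderiv
  rw [partialE, h₂]
  simp [Pi.single_apply]
  ring

theorem divDiff_gaussianOp (i j : Fin N) (c : ℝ) :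
    divDiff i j * gaussianOp N η c = gaussianOp N η c * divDiff i j := by
  have h : Commute (mulOp (invDiff i j) (contDiffOn_invDiff i j)) (gaussianOp N η c) :=
    LinearMap.ext fun _ => ext_on fun _ _ => mul_left_comm _ _ _
  exact (h.mul_left ((Commute.one_left _).sub_left (permOp_gaussianOp _ c))).eq

/-- The Gaussian is symmetric, so the divided differences pass through it; only the derivative sees
it and contributes its logarithmic derivative `y_i`. -/
theorem dunklYOp_gaussianOp (hN : 1 ≤ N) (hη : 0 < η) (i : Fin N) :
    dunklYOp N η i * gaussianOp N η (1 / 2) =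
      gaussianOp N η (1 / 2) * (dunklYOp N η i + yOp N η i) := by
  have h : mulOp _ (contDiffOn_partialE (contDiffOn_gaussian N η (1 / 2)) i) =
      scale N η • (gaussianOp N η (1 / 2) * yOp N η i) :=
    LinearMap.ext fun f => ext_on fun E _ => by
      rw [mulOp_apply, partialE_gaussian, LinearMap.smul_apply, coe_smul_apply,
        Module.End.mul_apply, gaussianOp_apply, yOp, LinearMap.smul_apply, coe_smul_apply,
        coordOp_apply, y]
      ring
  have h' : partialOp i * gaussianOp N η (1 / 2) = gaussianOp N η (1 / 2) * partialOp i +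
      scale N η • (gaussianOp N η (1 / 2) * yOp N η i) := by
    rw [← h, gaussianOp, partialOp_mulOp]
  rw [dunklYOp, dunklOp, smul_mul_assoc, add_mul, h', smul_mul_assoc, Finset.sum_mul,
    Finset.sum_congr rfl fun j _ => divDiff_gaussianOp i j _, ← Finset.mul_sum]
  simp only [mul_add, smul_add, mul_smul_comm, smul_smul,
    inv_mul_cancel₀ (scale_pos hN hη).ne', one_smul]
  abel

theorem yOp_gaussianOp (i : Fin N) (c : ℝ) :
    yOp N η i * gaussianOp N η c = gaussianOp N η c * yOp N η i := by
  have h : coordOp i * gaussianOp N η c = gaussianOp N η c * coordOp i :=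
    LinearMap.ext fun _ => ext_on fun _ _ => mul_left_comm _ _ _
  rw [yOp, smul_mul_assoc, mul_smul_comm, h]

/-- The operator `∑ D_i² - 2 ∑ y_i D_i - N(N+1)/2`, which agrees with the Schwinger-Dyson operator
on symmetric functions. -/
def lsdOp (N : ℕ) (η : ℝ) : Module.End ℝ (SmoothDistinct N) :=
  ∑ i, (dunklYOp N η i * dunklYOp N η i - 2 * (yOp N η i * dunklYOp N η i)) -
    ((N : ℝ) * (N + 1) / 2) • 1

/-- After the shift, `(D + y)² - 2y(D + y) = D² - y² + [D, y]`. -/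
theorem lsdOp_gaussianOp (hN : 1 ≤ N) (hη : 0 < η) :
    lsdOp N η * gaussianOp N η (1 / 2) = gaussianOp N η (1 / 2) *
      ((-2 : ℝ) • calogero (yOp N η) (dunklYOp N η) +
        ∑ i, dunklBracket (fun i j => permOp (Equiv.swap i j)) i i -
        ((N : ℝ) * (N + 1) / 2) • 1) := by
  rw [lsdOp, calogero, smul_smul, show (-2 : ℝ) * (1 / 2) = -1 by norm_num, neg_one_smul,
    sub_mul, Finset.sum_mul, mul_sub, smul_mul_assoc, mul_smul_comm, one_mul, mul_one,
    ← Finset.sum_neg_distrib, ← Finset.sum_add_distrib, Finset.mul_sum]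
  congr 1
  refine Finset.sum_congr rfl fun i _ => ?_
  have h₁ := dunklYOp_gaussianOp hN hη i
  have h₂ := yOp_gaussianOp (η := η) i (1 / 2)
  rw [← dunklYOp_yOp hN hη i i]
  have e₁ : dunklYOp N η i * dunklYOp N η i * gaussianOp N η (1 / 2) =
      gaussianOp N η (1 / 2) * ((dunklYOp N η i + yOp N η i) * (dunklYOp N η i + yOp N η i)) := by
    rw [mul_assoc, h₁, ← mul_assoc, h₁, mul_assoc]
  have e₂ : yOp N η i * dunklYOp N η i * gaussianOp N η (1 / 2) =
      gaussianOp N η (1 / 2) * (yOp N η i * (dunklYOp N η i + yOp N η i)) := by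
    rw [mul_assoc, h₁, ← mul_assoc, h₂, mul_assoc]
  rw [sub_mul, mul_assoc 2, e₁, e₂]
  noncomm_ring

/-- Functions invariant under all permutations of the coordinates. -/
def IsSymmetric (f : SmoothDistinct N) : Prop := ∀ σ : Equiv.Perm (Fin N), permOp σ f = f

theorem IsSymmetric.apply_of_commute {f : SmoothDistinct N} (hf : IsSymmetric f)
    {T : Module.End ℝ (SmoothDistinct N)} (hT : ∀ σ, Commute (permOp σ) T) :
    IsSymmetric (T f) := fun σ => by
  rw [← Module.End.mul_apply, (hT σ).eq, Module.End.mul_apply, hf]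

/-- Every exchange acts as the identity, so the sum is `N (1 + (N - 1)/2)`, exactly the constant
subtracted in the Schwinger-Dyson operator. -/
theorem IsSymmetric.sum_dunklBracket {f : SmoothDistinct N} (hf : IsSymmetric f) :
    (∑ i, dunklBracket (fun i j => permOp (Equiv.swap i j)) i i) f =
      ((N : ℝ) * (N + 1) / 2) • f := by
  have h (i : Fin N) : dunklBracket (fun i j => permOp (Equiv.swap i j)) i i f =
      (1 + (1 / 2 : ℝ) * (N - 1)) • f := by
    have hN : 1 ≤ N := i.pos
    rw [dunklBracket, if_pos rfl, LinearMap.add_apply, LinearMap.smul_apply, LinearMap.sum_apply,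
      Finset.sum_congr rfl fun k _ => hf (Equiv.swap i k), Finset.sum_const,
      Finset.card_erase_of_mem (Finset.mem_univ i), Finset.card_univ, Fintype.card_fin,
      ← Nat.cast_smul_eq_nsmul ℝ, smul_smul, Module.End.one_apply, add_smul, one_smul,
      Nat.cast_sub hN, Nat.cast_one]
  rw [LinearMap.sum_apply, Finset.sum_congr rfl fun i _ => h i, Finset.sum_const,
    Finset.card_univ, Fintype.card_fin, ← Nat.cast_smul_eq_nsmul ℝ, smul_smul]
  congr 1
  ring

theorem IsSymmetric.lsdOp_gaussianOp {f : SmoothDistinct N} (hf : IsSymmetric f) (hN : 1 ≤ N)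
    (hη : 0 < η) : lsdOp N η (gaussianOp N η (1 / 2) f) =
      (-2 : ℝ) • gaussianOp N η (1 / 2) (calogero (yOp N η) (dunklYOp N η) f) := by
  rw [← Module.End.mul_apply, SymPhi4.lsdOp_gaussianOp hN hη, Module.End.mul_apply,
    LinearMap.sub_apply, LinearMap.add_apply, hf.sum_dunklBracket, LinearMap.smul_apply,
    LinearMap.smul_apply, Module.End.one_apply, add_sub_cancel_right, map_smul]

/-! ### Agreement of the operators -/

theorem IsSymmetric.dunklOp_apply {f : SmoothDistinct N} (hf : IsSymmetric f) (i : Fin N) :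
    dunklOp i f = partialOp i f := by
  have h (j : Fin N) : divDiff i j f = 0 := by
    rw [divDiff, Module.End.mul_apply, LinearMap.sub_apply, hf, Module.End.one_apply, sub_self,
      map_zero]
  simp [dunklOp, h]

/-- Although `f` is symmetric, `∂_i f` is not: the exchange maps it to `∂_j f`. This makes the
exchange part of `D_i²` nontrivial. -/
theorem IsSymmetric.divDiff_partialOp_apply {f : SmoothDistinct N} (hf : IsSymmetric f)
    (i j : Fin N) (E : Fin N → ℝ) : divDiff i j (partialOp i f) E =
      invDiff i j E * (partialOp i f E - partialOp j f E) := by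
  have h : permOp (Equiv.swap i j) (partialOp i f) = partialOp j f := by
    rw [← Module.End.mul_apply, permOp_partialOp, Module.End.mul_apply, hf,
      Equiv.swap_apply_left]
  rw [divDiff_apply, ← h]
  rfl

/-- By antisymmetry the two halves of the double sum agree, so the factor `β = 1/2` of the Dunkl
operators becomes the coefficient `1` of the first-order term of `LSD`. -/
theorem sum_invDiff_antisymm (E : Fin N → ℝ) (v : Fin N → ℝ) :
    1 / 2 * ∑ i, ∑ j, invDiff i j E * (v i - v j) = ∑ i, ∑ j, invDiff i j E * v i := by
  have h : ∑ i, ∑ j, invDiff i j E * v j = -∑ i, ∑ j, invDiff i j E * v i := by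
    rw [Finset.sum_comm, ← Finset.sum_neg_distrib]
    refine Finset.sum_congr rfl fun i _ => ?_
    rw [← Finset.sum_neg_distrib]
    refine Finset.sum_congr rfl fun j _ => ?_
    rw [invDiff, invDiff, ← neg_sub (E i), one_div_neg_eq_neg_one_div, neg_mul]
  simp only [mul_sub, Finset.sum_sub_distrib]
  rw [h]
  ring

theorem sum_erase_invDiff (i : Fin N) (E : Fin N → ℝ) (g : Fin N → ℝ) :
    ∑ j ∈ Finset.univ.erase i, 1 / (E i - E j) * g j = ∑ j, invDiff i j E * g j :=
  Finset.sum_erase _ (by simp)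

theorem LSD_congr {f g : (Fin N → ℝ) → ℝ} (h : Set.EqOn f g (distinctPoints N)) {E : Fin N → ℝ}
    (hE : E ∈ distinctPoints N) : LSD N η f E = LSD N η g E := by
  have h₁ (i : Fin N) : Set.EqOn (partialE i f) (partialE i g) (distinctPoints N) :=
    fun E hE => partialE_congr h hE i
  simp only [LSD, h hE, h₁ _ hE, partialE_congr (h₁ _) hE]

theorem IsSymmetric.lsdOp_apply {f : SmoothDistinct N} (hf : IsSymmetric f) (hN : 1 ≤ N)
    (hη : 0 < η) {E : Fin N → ℝ} (hE : E ∈ distinctPoints N) :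
    lsdOp N η f E = LSD N η f E := by
  have hs := (scale_pos hN hη).ne'
  have hs' : (scale N η)⁻¹ * (scale N η)⁻¹ = η / N := by
    rw [← mul_inv, scale_mul_self hη, inv_div]
  have h₁ (i : Fin N) : (dunklYOp N η i * dunklYOp N η i) f E =
      η / N * (partialE i (partialE i f) E +
        1 / 2 * ∑ j, invDiff i j E * (partialE i f E - partialE j f E)) := by
    rw [dunklYOp, smul_mul_smul_comm, hs', LinearMap.smul_apply, coe_smul_apply,
      Module.End.mul_apply, hf.dunklOp_apply, dunklOp, LinearMap.add_apply, coe_add_apply,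
      LinearMap.smul_apply, coe_smul_apply, LinearMap.sum_apply, coe_sum_apply,
      partialOp_apply _ _ hE, partialE_congr (fun E' hE' => partialOp_apply i f hE') hE]
    congr 3
    refine Finset.sum_congr rfl fun j _ => ?_
    rw [hf.divDiff_partialOp_apply, partialOp_apply _ _ hE, partialOp_apply _ _ hE]
  have h₂ (i : Fin N) : (2 * (yOp N η i * dunklYOp N η i)) f E = 2 * (E i * partialE i f E) := by
    rw [dunklYOp, yOp, smul_mul_smul_comm, mul_inv_cancel₀ hs, one_smul, two_mul,
      LinearMap.add_apply, coe_add_apply, Module.End.mul_apply, hf.dunklOp_apply, coordOp_apply,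
      partialOp_apply _ _ hE, two_mul]
  rw [lsdOp, LinearMap.sub_apply, coe_sub_apply, LinearMap.sum_apply, coe_sum_apply,
    Finset.sum_congr rfl fun i _ => by rw [LinearMap.sub_apply, coe_sub_apply, h₁, h₂],
    Finset.sum_sub_distrib, ← Finset.mul_sum, Finset.sum_add_distrib, ← Finset.mul_sum,
    sum_invDiff_antisymm, ← Finset.mul_sum, LinearMap.smul_apply, coe_smul_apply,
    Module.End.one_apply, LSD]
  simp only [sum_erase_invDiff _ E fun _ => _]
  ring

/-- Agreement at distinct points suffices: that set is open, so derivatives agree, and permutation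
invariant, so exchanged values agree. -/
theorem dunklY_eqOn {f : (Fin N → ℝ) → ℝ} {g : SmoothDistinct N}
    (h : Set.EqOn f g (distinctPoints N)) (i : Fin N) :
    Set.EqOn (dunklY N η i f) (dunklYOp N η i g) (distinctPoints N) := fun E hE => by
  rw [dunklY, dunklE, dunklYOp, LinearMap.smul_apply, coe_smul_apply, dunklOp,
    LinearMap.add_apply, coe_add_apply, LinearMap.smul_apply, coe_smul_apply,
    LinearMap.sum_apply, coe_sum_apply, partialOp_apply _ _ hE, partialE_congr h hE,
    sum_erase_invDiff i E]
  congr 3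
  refine Finset.sum_congr rfl fun j _ => ?_
  rw [divDiff_apply, exchange, h hE, h ((comp_perm_mem_distinctPoints _).2 hE)]

theorem annihilate_eqOn {f : (Fin N → ℝ) → ℝ} {g : SmoothDistinct N}
    (h : Set.EqOn f g (distinctPoints N)) (i : Fin N) :
    Set.EqOn (annihilate N η i f) (((1 / √2 : ℝ) • (yOp N η i + dunklYOp N η i)) g)
      (distinctPoints N) := fun E hE => by
  rw [annihilate, dunklY_eqOn h i hE, h hE, y, mul_assoc]
  rfl

theorem create_eqOn {f : (Fin N → ℝ) → ℝ} {g : SmoothDistinct N}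
    (h : Set.EqOn f g (distinctPoints N)) (i : Fin N) :
    Set.EqOn (create N η i f) (((1 / √2 : ℝ) • (yOp N η i - dunklYOp N η i)) g)
      (distinctPoints N) := fun E hE => by
  rw [create, dunklY_eqOn h i hE, h hE, y, mul_assoc]
  rfl

theorem create_iterate_eqOn {f : (Fin N → ℝ) → ℝ} {g : SmoothDistinct N}
    (h : Set.EqOn f g (distinctPoints N)) (i : Fin N) (n : ℕ) :
    Set.EqOn ((create N η i)^[n] f) ((((1 / √2 : ℝ) • (yOp N η i - dunklYOp N η i)) ^ n) g)
      (distinctPoints N) := by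
  induction n with
  | zero => exact h
  | succ n ih =>
    rw [Function.iterate_succ_apply', pow_succ', Module.End.mul_apply]
    exact create_eqOn ih i

theorem virasoro_eqOn {f : (Fin N → ℝ) → ℝ} {g : SmoothDistinct N}
    (h : Set.EqOn f g (distinctPoints N)) (α : ℝ) (m : ℤ) :
    Set.EqOn (virasoro N η α m f) (virasoroOp (yOp N η) (dunklYOp N η) α (m + 1).toNat g)
      (distinctPoints N) := fun E hE => by
  rw [virasoro, virasoroOp, LinearMap.sum_apply, coe_sum_apply]
  refine Finset.sum_congr rfl fun i _ => ?_
  rw [create_iterate_eqOn (annihilate_eqOn h i) i _ hE,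
    annihilate_eqOn (create_iterate_eqOn h i _) i hE]
  rfl

theorem virasoroConj_eqOn {f : (Fin N → ℝ) → ℝ} {g : SmoothDistinct N}
    (h : Set.EqOn f g (distinctPoints N)) (α : ℝ) (m : ℤ) :
    Set.EqOn (virasoroConj N η α m f)
      (gaussianOp N η (1 / 2) (virasoroOp (yOp N η) (dunklYOp N η) α (m + 1).toNat
        (gaussianOp N η (-(1 / 2)) g))) (distinctPoints N) := fun E hE => by
  rw [virasoroConj, gaussianOp_apply]
  congr 1
  refine virasoro_eqOn (fun E' hE' => ?_) α m hE
  rw [gaussianOp_apply, h hE', neg_mul]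

/-- Virasoro generators map symmetric solutions of the Schwinger-Dyson equation to eigenfunctions
of the Schwinger-Dyson operator. -/
theorem LSD_virasoroConj (hN : 1 ≤ N) (hη : 0 < η) (α : ℝ) {m : ℤ} (hm : -1 ≤ m)
    {f : (Fin N → ℝ) → ℝ} (hf : ContDiffOn ℝ ∞ f (distinctPoints N))
    (hsymm : ∀ (σ : Equiv.Perm (Fin N)) (E), f (E ∘ σ) = f E)
    (hLSD : ∀ E ∈ distinctPoints N, LSD N η f E = 0) :
    ContDiffOn ℝ ∞ (virasoroConj N η α m f) (distinctPoints N) ∧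
      ∀ E ∈ distinctPoints N,
        LSD N η (virasoroConj N η α m f) E = -2 * (m : ℝ) * virasoroConj N η α m f E := by
  set z := restrict f hf with hz
  have hfz : Set.EqOn f z (distinctPoints N) := fun E hE => (restrict_apply hf hE).symm
  have hzs : IsSymmetric z := fun σ => ext_on fun E hE => by
    rw [permOp_apply, restrict_apply _ hE,
      restrict_apply _ ((comp_perm_mem_distinctPoints σ).2 hE), hsymm]
  set h := gaussianOp N η (-(1 / 2)) z with hh
  have hhs : IsSymmetric h := hzs.apply_of_commute fun σ => permOp_gaussianOp σ _
  have hgh : gaussianOp N η (1 / 2) h = z := by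
    rw [hh, ← Module.End.mul_apply, gaussianOp_mul_neg, Module.End.one_apply]
  have hinv : gaussianOp N η (-(1 / 2)) * gaussianOp N η (1 / 2) = 1 := by
    simpa using gaussianOp_mul_neg (N := N) (η := η) (-(1 / 2))
  have hz₀ : lsdOp N η z = 0 := ext_on fun E hE => by
    rw [hzs.lsdOp_apply hN hη hE, ← LSD_congr hfz hE, hLSD E hE, coe_zero_apply]
  -- Conjugation turns `lsdOp z = 0` into `-2 G H h = 0`, and the Gaussian factor `G` is invertible.
  have hH : calogero (yOp N η) (dunklYOp N η) h = 0 := by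
    have h₁ := hhs.lsdOp_gaussianOp hN hη
    rw [hgh, hz₀] at h₁
    have h₂ := (smul_eq_zero.1 h₁.symm).resolve_left (by norm_num)
    rw [← Module.End.one_apply (R := ℝ) (calogero (yOp N η) (dunklYOp N η) h), ← hinv,
      Module.End.mul_apply, h₂, map_zero]
  set L := virasoroOp (yOp N η) (dunklYOp N η) α (m + 1).toNat with hL
  have hLs : IsSymmetric (L h) := hhs.apply_of_commute fun σ =>
    commute_virasoroOp (semiconjBy_yOp σ) (semiconjBy_dunklYOp σ) α _
  have hHL : calogero (yOp N η) (dunklYOp N η) (L h) = (m : ℝ) • L h := by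
    have h₁ := congrArg (fun T => T h)
      (calogero_commutator_virasoroOp_dunkl (N := N) hN hη α (m + 1).toNat)
    -- The bound `-1 ≤ m` ensures that `toNat` does not truncate, so the weight `(m + 1) - 1` is
    -- `m`.
    have h₂ : (((m + 1).toNat : ℕ) : ℝ) = m + 1 := by
      have : (((m + 1).toNat : ℕ) : ℤ) = m + 1 := Int.toNat_of_nonneg (by omega)
      exact_mod_cast congrArg (Int.cast : ℤ → ℝ) this
    simpa only [LinearMap.sub_apply, Module.End.mul_apply, hH, map_zero, sub_zero,
      LinearMap.smul_apply, h₂, add_sub_cancel_right] using h₁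
  have hconj := virasoroConj_eqOn (η := η) hfz α m
  refine ⟨(contDiffOn _).congr hconj, fun E hE => ?_⟩
  have hu : IsSymmetric (gaussianOp N η (1 / 2) (L h)) :=
    hLs.apply_of_commute fun σ => permOp_gaussianOp σ _
  rw [LSD_congr hconj hE, hconj hE, ← hu.lsdOp_apply hN hη hE, hLs.lsdOp_gaussianOp hN hη, hHL,
    map_smul, smul_smul, coe_smul_apply]

end

/-! ### Integrability against the quartic weight -/

section

variable {N : ℕ}

theorem symMatrix_comm (x : UpperIndex N → ℝ) (i j : Fin N) :
    symMatrix x i j = symMatrix x j i := by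
  simp only [symMatrix, Matrix.of_apply, min_comm i j, max_comm i j]

theorem symMatrix_apply (x : UpperIndex N → ℝ) (c : UpperIndex N) :
    symMatrix x c.1.1 c.1.2 = x c := by
  simp only [symMatrix, Matrix.of_apply]
  congr 1
  exact Subtype.ext (Prod.ext (min_eq_left c.2) (max_eq_right c.2))

/-- The square of the symmetric matrix with the given entries. -/
def symSq (x : UpperIndex N → ℝ) : Matrix (Fin N) (Fin N) ℝ := symMatrix x * symMatrix x

theorem symSq_comm (x : UpperIndex N → ℝ) (i j : Fin N) : symSq x i j = symSq x j i := by
  simp only [symSq, Matrix.mul_apply]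
  exact Finset.sum_congr rfl fun k _ => by
    rw [symMatrix_comm x i k, symMatrix_comm x k j, mul_comm]

theorem symSq_self (x : UpperIndex N → ℝ) (i : Fin N) :
    symSq x i i = ∑ k, symMatrix x i k ^ 2 := by
  simp only [symSq, Matrix.mul_apply]
  exact Finset.sum_congr rfl fun k _ => by rw [symMatrix_comm x k i, sq]

theorem symSq_self_nonneg (x : UpperIndex N → ℝ) (i : Fin N) : 0 ≤ symSq x i i := by
  rw [symSq_self]; positivity

/-- The trace of the square of the symmetric matrix with the given entries. -/
def traceSq (x : UpperIndex N → ℝ) : ℝ := (symSq x).trace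

theorem traceSq_eq (x : UpperIndex N → ℝ) : traceSq x = ∑ i, symSq x i i := rfl

theorem traceSq_nonneg (x : UpperIndex N → ℝ) : 0 ≤ traceSq x := by
  rw [traceSq_eq]
  exact Finset.sum_nonneg fun i _ => symSq_self_nonneg x i

theorem symSq_self_le_traceSq (x : UpperIndex N → ℝ) (i : Fin N) : symSq x i i ≤ traceSq x :=
  Finset.single_le_sum (f := fun i => symSq x i i) (fun i _ => symSq_self_nonneg x i)
    (Finset.mem_univ i)

theorem sq_symMatrix_le_traceSq (x : UpperIndex N → ℝ) (i j : Fin N) :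
    symMatrix x i j ^ 2 ≤ traceSq x := by
  refine le_trans ?_ (symSq_self_le_traceSq x i)
  rw [symSq_self]
  exact Finset.single_le_sum (f := fun j => symMatrix x i j ^ 2) (fun _ _ => sq_nonneg _)
    (Finset.mem_univ j)

theorem sum_sq_le_traceSq (x : UpperIndex N → ℝ) : ∑ c, x c ^ 2 ≤ traceSq x := by
  have h : traceSq x = ∑ p : Fin N × Fin N, symMatrix x p.1 p.2 ^ 2 := by
    rw [traceSq_eq, Fintype.sum_prod_type]
    exact Finset.sum_congr rfl fun i _ => symSq_self x i
  rw [h]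
  calc ∑ c, x c ^ 2 = ∑ c : UpperIndex N, symMatrix x c.1.1 c.1.2 ^ 2 :=
        Finset.sum_congr rfl fun c _ => by rw [symMatrix_apply]
    _ = ∑ p ∈ Finset.univ.map (Function.Embedding.subtype fun p : Fin N × Fin N => p.1 ≤ p.2),
          symMatrix x p.1 p.2 ^ 2 := by rw [Finset.sum_map]; rfl
    _ ≤ _ := Finset.sum_le_sum_of_subset_of_nonneg (Finset.subset_univ _)
        fun _ _ _ => sq_nonneg _

theorem trace_symSq_mul_symSq (x : UpperIndex N → ℝ) :
    (symSq x * symSq x).trace = ∑ i, ∑ j, symSq x i j ^ 2 := by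
  simp only [Matrix.trace, Matrix.diag_apply, Matrix.mul_apply]
  exact Finset.sum_congr rfl fun i _ => Finset.sum_congr rfl fun j _ => by
    rw [symSq_comm x j i, sq]

/-- Cauchy-Schwarz on the diagonal of `Φ²`, followed by adding the squares of its off-diagonal
entries. This lets the quartic term dominate every multiple of `Tr Φ²`. -/
theorem sq_traceSq_le (x : UpperIndex N → ℝ) :
    traceSq x ^ 2 ≤ N * (symSq x * symSq x).trace := by
  have h := sq_sum_le_card_mul_sum_sq (s := Finset.univ) (f := fun i => symSq x i i)
  rw [Finset.card_univ, Fintype.card_fin] at h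
  refine h.trans (mul_le_mul_of_nonneg_left ?_ (Nat.cast_nonneg N))
  rw [trace_symSq_mul_symSq]
  exact Finset.sum_le_sum fun i _ => Finset.single_le_sum (f := fun j => symSq x i j ^ 2)
    (fun _ _ => sq_nonneg _) (Finset.mem_univ i)

theorem action_eq (η : ℝ) (E : Fin N → ℝ) (x : UpperIndex N → ℝ) :
    action η (Matrix.diagonal E) (symMatrix x) =
      N * ∑ i, E i * symSq x i i + N * (η / 4 * (symSq x * symSq x).trace) := by
  have h₂ : symMatrix x ^ 2 = symSq x := sq _
  have h₄ : symMatrix x ^ 4 = symSq x * symSq x := by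
    rw [symSq, ← sq, ← sq, ← pow_mul]
  rw [action, h₂, h₄, Matrix.trace_add, Matrix.trace_smul, mul_add, smul_eq_mul]
  congr 2
  simp [Matrix.trace]

theorem weight_eq (η : ℝ) (E : Fin N → ℝ) (x : UpperIndex N → ℝ) :
    weight η (Matrix.diagonal E) x = Real.exp (-(N * ∑ i, E i * symSq x i i)) *
      Real.exp (-(N * (η / 4 * (symSq x * symSq x).trace))) := by
  rw [weight, action_eq, neg_add, Real.exp_add]

/-! ### Functions of at most exponential growth in `Tr Φ²` -/

/-- Continuous functions growing at most exponentially in `Tr Φ²`. -/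
def Tame (p : (UpperIndex N → ℝ) → ℝ) : Prop :=
  Continuous p ∧ ∃ a C : ℝ, 0 ≤ a ∧ 0 ≤ C ∧ ∀ x, |p x| ≤ C * Real.exp (a * traceSq x)

namespace Tame

variable {p q : (UpperIndex N → ℝ) → ℝ}

theorem const (c : ℝ) : Tame fun _ : UpperIndex N → ℝ => c :=
  ⟨continuous_const, 0, |c|, le_rfl, abs_nonneg c, fun x => by simp⟩

theorem mul (hp : Tame p) (hq : Tame q) : Tame fun x => p x * q x := by
  obtain ⟨cp, a, C, ha, hC, h⟩ := hp
  obtain ⟨cq, b, D, hb, hD, k⟩ := hq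
  refine ⟨cp.mul cq, a + b, C * D, by positivity, by positivity, fun x => ?_⟩
  rw [abs_mul, add_mul, Real.exp_add, mul_mul_mul_comm]
  exact mul_le_mul (h x) (k x) (abs_nonneg _) (by positivity)

theorem add (hp : Tame p) (hq : Tame q) : Tame fun x => p x + q x := by
  obtain ⟨cp, a, C, ha, hC, h⟩ := hp
  obtain ⟨cq, b, D, hb, hD, k⟩ := hq
  refine ⟨cp.add cq, a + b, C + D, by positivity, by positivity, fun x => ?_⟩
  have hT := traceSq_nonneg x
  have h₁ : Real.exp (a * traceSq x) ≤ Real.exp ((a + b) * traceSq x) := by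
    gcongr; linarith
  have h₂ : Real.exp (b * traceSq x) ≤ Real.exp ((a + b) * traceSq x) := by
    gcongr; linarith
  calc |p x + q x| ≤ |p x| + |q x| := abs_add_le _ _
    _ ≤ C * Real.exp (a * traceSq x) + D * Real.exp (b * traceSq x) := add_le_add (h x) (k x)
    _ ≤ C * Real.exp ((a + b) * traceSq x) + D * Real.exp ((a + b) * traceSq x) := by gcongr
    _ = _ := by ring

theorem neg (hp : Tame p) : Tame fun x => -p x := by
  simpa using (const (-1)).mul hp

theorem sub (hp : Tame p) (hq : Tame q) : Tame fun x => p x - q x := by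
  simpa only [sub_eq_add_neg] using hp.add hq.neg

theorem abs (hp : Tame p) : Tame fun x => |p x| :=
  ⟨hp.1.abs, by simpa using hp.2⟩

theorem sum {ι : Type*} {s : Finset ι} {f : ι → (UpperIndex N → ℝ) → ℝ}
    (h : ∀ i ∈ s, Tame (f i)) : Tame fun x => ∑ i ∈ s, f i x := by
  induction s using Finset.cons_induction with
  | empty => simpa using const 0
  | cons a s ha ih =>
    simp only [Finset.sum_cons]
    exact (h a (Finset.mem_cons_self a s)).add (ih fun i hi => h i (Finset.mem_cons_of_mem hi))

theorem congr (hp : Tame p) (h : ∀ x, q x = p x) : Tame q := by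
  rwa [show q = p from funext h]

theorem matrix_mul {A B : (UpperIndex N → ℝ) → Matrix (Fin N) (Fin N) ℝ}
    (hA : ∀ i j, Tame fun x => A x i j) (hB : ∀ i j, Tame fun x => B x i j) (i j : Fin N) :
    Tame fun x => (A x * B x) i j := by
  simp only [Matrix.mul_apply]
  exact sum fun k _ => (hA i k).mul (hB k j)

theorem matrix_trace {A : (UpperIndex N → ℝ) → Matrix (Fin N) (Fin N) ℝ}
    (hA : ∀ i j, Tame fun x => A x i j) : Tame fun x => (A x).trace :=
  sum fun i _ => hA i i

theorem symMatrix_apply (i j : Fin N) : Tame fun x => symMatrix x i j := by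
  refine ⟨continuous_apply _, 1, 1, zero_le_one, zero_le_one, fun x => ?_⟩
  have h₁ := sq_symMatrix_le_traceSq x i j
  have h₂ := Real.add_one_le_exp (traceSq x)
  rw [one_mul, one_mul]
  refine le_trans ?_ h₂
  rw [← sq_abs] at h₁
  nlinarith [sq_nonneg (|symMatrix x i j| - 1)]

theorem coord (c : UpperIndex N) : Tame fun x => x c :=
  (symMatrix_apply c.1.1 c.1.2).congr fun x => (SymPhi4.symMatrix_apply x c).symm

theorem symSq_apply (i j : Fin N) : Tame fun x => symSq x i j :=
  matrix_mul symMatrix_apply symMatrix_apply i j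

theorem exp_traceSq {a : ℝ} (ha : 0 ≤ a) :
    Tame fun x : UpperIndex N → ℝ => Real.exp (a * traceSq x) :=
  ⟨Real.continuous_exp.comp (continuous_const.mul (matrix_trace symSq_apply).1), a, 1, ha,
    zero_le_one, fun x => by rw [abs_of_pos (Real.exp_pos _), one_mul]⟩

end Tame

theorem integrable_exp_neg_traceSq (N : ℕ) :
    Integrable fun x : UpperIndex N → ℝ => Real.exp (-traceSq x) := by
  have h : Integrable fun x : UpperIndex N → ℝ => ∏ c, Real.exp (-1 * x c ^ 2) :=
    Integrable.fintype_prod fun _ => integrable_exp_neg_mul_sq one_pos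
  refine h.mono' (Real.continuous_exp.comp
    (Tame.matrix_trace Tame.symSq_apply).1.neg).aestronglyMeasurable (ae_of_all _ fun x => ?_)
  rw [Real.norm_of_nonneg (Real.exp_pos _).le, ← Real.exp_sum]
  have := sum_sq_le_traceSq x
  gcongr
  simpa using this

/-- With `T = Tr Φ²` the quartic exponent is at most `-(η/4) T²`, and completing the square gives
`aT - (η/4) T² ≤ (a + 1)²/η - T`. The extra `1` in `a + 1` leaves the integrable majorant `exp
(-T)`. -/
theorem Tame.integrable_mul_exp {p : (UpperIndex N → ℝ) → ℝ} (hp : Tame p) {η : ℝ}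
    (hη : 0 < η) :
    Integrable fun x => p x * Real.exp (-(N * (η / 4 * (symSq x * symSq x).trace))) := by
  obtain ⟨cp, a, C, ha, hC, h⟩ := hp
  have hc : Continuous fun x : UpperIndex N → ℝ => (symSq x * symSq x).trace :=
    (Tame.matrix_trace (Tame.matrix_mul Tame.symSq_apply Tame.symSq_apply)).1
  refine ((integrable_exp_neg_traceSq N).const_mul (C * Real.exp ((a + 1) ^ 2 / η))).mono'
    (cp.mul (by fun_prop)).aestronglyMeasurable (ae_of_all _ fun x => ?_)
  rw [norm_mul, Real.norm_of_nonneg (Real.exp_pos _).le, Real.norm_eq_abs, mul_assoc,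
    ← Real.exp_add]
  refine (mul_le_mul_of_nonneg_right (h x) (Real.exp_pos _).le).trans ?_
  simp only [mul_assoc, ← Real.exp_add]
  refine mul_le_mul_of_nonneg_left (Real.exp_le_exp.2 ?_) hC
  have h₁ := sq_traceSq_le x
  have h₂ : (a + 1) * traceSq x - η / 4 * traceSq x ^ 2 ≤ (a + 1) ^ 2 / η := by
    rw [le_div_iff₀ hη]
    nlinarith [sq_nonneg (η / 2 * traceSq x - (a + 1))]
  nlinarith

theorem abs_sum_symSq_le (E : Fin N → ℝ) (x : UpperIndex N → ℝ) :
    |∑ i, E i * symSq x i i| ≤ ‖E‖ * traceSq x := by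
  refine (Finset.abs_sum_le_sum_abs _ _).trans ?_
  rw [traceSq, Matrix.trace, Finset.mul_sum]
  refine Finset.sum_le_sum fun i _ => ?_
  rw [abs_mul, abs_of_nonneg (symSq_self_nonneg x i)]
  exact mul_le_mul_of_nonneg_right (norm_le_pi_norm E i) (symSq_self_nonneg x i)

theorem exp_neg_sum_symSq_le {E : Fin N → ℝ} {B : ℝ} (hE : ‖E‖ ≤ B) (x : UpperIndex N → ℝ) :
    Real.exp (-(N * ∑ i, E i * symSq x i i)) ≤ Real.exp (N * B * traceSq x) := by
  gcongr
  have h₁ := neg_le_of_abs_le (abs_sum_symSq_le E x)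
  have h₂ := mul_le_mul_of_nonneg_right hE (traceSq_nonneg x)
  have h₃ : -∑ i, E i * symSq x i i ≤ B * traceSq x := by linarith
  calc -(N * ∑ i, E i * symSq x i i) = N * -∑ i, E i * symSq x i i := by ring
    _ ≤ N * (B * traceSq x) := mul_le_mul_of_nonneg_left h₃ (Nat.cast_nonneg N)
    _ = _ := by ring

/-- The coefficients `E_i` may be negative, so this factor can grow. Allowing exponential growth in
`Tame` lets it be absorbed into the observable. -/
theorem Tame.exp_neg_sum_symSq (E : Fin N → ℝ) :
    Tame fun x => Real.exp (-(N * ∑ i, E i * symSq x i i)) := by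
  refine ⟨Real.continuous_exp.comp ((continuous_const.mul (Tame.sum fun i _ =>
    (Tame.const (E i)).mul (Tame.symSq_apply i i)).1).neg), N * ‖E‖, 1, by positivity, zero_le_one,
    fun x => ?_⟩
  rw [abs_of_pos (Real.exp_pos _), one_mul]
  exact exp_neg_sum_symSq_le le_rfl x

theorem Tame.integrable {p : (UpperIndex N → ℝ) → ℝ} (hp : Tame p) {η : ℝ} (hη : 0 < η)
    (E : Fin N → ℝ) : Integrable fun x => p x * weight η (Matrix.diagonal E) x := by
  simpa only [weight_eq, mul_assoc] using
    (hp.mul (Tame.exp_neg_sum_symSq E)).integrable_mul_exp hη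

/-! ### Expectation values -/

/-- The unnormalised expectation value of `p`. -/
def expect (η : ℝ) (p : (UpperIndex N → ℝ) → ℝ) (E : Fin N → ℝ) : ℝ :=
  ∫ x, p x * weight η (Matrix.diagonal E) x

theorem Z_eq_expect (η : ℝ) : Z N η = expect η fun _ => 1 := by
  funext E
  simp [Z, partitionFunction, expect]

variable {η : ℝ} {p q : (UpperIndex N → ℝ) → ℝ}

theorem expect_add (hη : 0 < η) (hp : Tame p) (hq : Tame q) (E : Fin N → ℝ) :
    expect η (fun x => p x + q x) E = expect η p E + expect η q E := by
  simp only [expect, add_mul]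
  exact integral_add (hp.integrable hη E) (hq.integrable hη E)

theorem expect_sub (hη : 0 < η) (hp : Tame p) (hq : Tame q) (E : Fin N → ℝ) :
    expect η (fun x => p x - q x) E = expect η p E - expect η q E := by
  simp only [expect, sub_mul]
  exact integral_sub (hp.integrable hη E) (hq.integrable hη E)

theorem expect_const_mul (c : ℝ) (E : Fin N → ℝ) :
    expect η (fun x => c * p x) E = c * expect η p E := by
  simp only [expect, mul_assoc]
  exact integral_const_mul _ _

theorem expect_sum (hη : 0 < η) {ι : Type*} {s : Finset ι} {f : ι → (UpperIndex N → ℝ) → ℝ}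
    (h : ∀ i ∈ s, Tame (f i)) (E : Fin N → ℝ) :
    expect η (fun x => ∑ i ∈ s, f i x) E = ∑ i ∈ s, expect η (f i) E := by
  simp only [expect, Finset.sum_mul]
  exact integral_finsetSum _ fun i hi => (h i hi).integrable hη E

theorem hasFDerivAt_mul_weight (c : ℝ) (E : Fin N → ℝ) (x : UpperIndex N → ℝ) :
    HasFDerivAt (fun E => c * weight η (Matrix.diagonal E) x)
      (∑ i, (-(N * symSq x i i) * c * weight η (Matrix.diagonal E) x) •
        (ContinuousLinearMap.proj i : (Fin N → ℝ) →L[ℝ] ℝ)) E := by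
  have h₁ : HasFDerivAt (fun E : Fin N → ℝ => ∑ i, E i * symSq x i i)
      (∑ i, symSq x i i • (ContinuousLinearMap.proj i : (Fin N → ℝ) →L[ℝ] ℝ)) E :=
    HasFDerivAt.fun_sum fun i _ => (hasFDerivAt_apply (𝕜 := ℝ) i E).mul_const _
  have h₂ := ((((h₁.const_mul (N : ℝ)).neg).exp).mul_const
    (Real.exp (-(N * (η / 4 * (symSq x * symSq x).trace))))).const_mul c
  simp only [weight_eq]
  refine h₂.congr_fderiv (ContinuousLinearMap.ext fun v => ?_)
  simp only [Pi.neg_apply, smul_apply, neg_apply, sum_apply, ContinuousLinearMap.proj_apply,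
    smul_eq_mul, Finset.mul_sum, ← Finset.sum_neg_distrib]
  exact Finset.sum_congr rfl fun i _ => by ring

theorem norm_smul_le_abs_of_norm_le_one {V : Type*} [NormedAddCommGroup V] [NormedSpace ℝ V]
    (c : ℝ) {v : V} (hv : ‖v‖ ≤ 1) : ‖c • v‖ ≤ |c| := by
  rw [norm_smul, Real.norm_eq_abs]
  exact mul_le_of_le_one_right (abs_nonneg c) hv

theorem integrable_sum_smul {α ι V : Type*} [MeasurableSpace α] {μ : Measure α}
    [NormedAddCommGroup V] [NormedSpace ℝ V] (s : Finset ι) {f : ι → α → ℝ} (L : ι → V)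
    (hf : ∀ i ∈ s, Integrable (f i) μ) : Integrable (fun x => ∑ i ∈ s, f i x • L i) μ :=
  integrable_finsetSum _ fun i hi => (hf i hi).smul_const (L i)

theorem integral_sum_smul {α ι V : Type*} [MeasurableSpace α] {μ : Measure α}
    [NormedAddCommGroup V] [NormedSpace ℝ V] [CompleteSpace V] (s : Finset ι)
    {f : ι → α → ℝ} (L : ι → V)
    (hf : ∀ i ∈ s, Integrable (f i) μ) :
    ∫ x, ∑ i ∈ s, f i x • L i ∂μ = ∑ i ∈ s, (∫ x, f i x ∂μ) • L i := by
  rw [integral_finsetSum _ fun i hi => (hf i hi).smul_const (L i)]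
  exact Finset.sum_congr rfl fun i _ => integral_smul_const _ _

theorem Tame.neg_symSq_mul (hp : Tame p) (i : Fin N) :
    Tame fun x => -(N * symSq x i i) * p x :=
  ((Tame.const (N : ℝ)).mul (Tame.symSq_apply i i)).neg.mul hp

/-- The bound is uniform over the unit ball around `E`, as differentiation under the integral
requires. -/
theorem norm_deriv_weight_le {E E' : Fin N → ℝ} (hE : ‖E' - E‖ < 1) (x : UpperIndex N → ℝ) :
    ‖∑ i, (-(N * symSq x i i) * p x * weight η (Matrix.diagonal E') x) •
      (ContinuousLinearMap.proj i : (Fin N → ℝ) →L[ℝ] ℝ)‖ ≤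
    (∑ i, |-(N * symSq x i i) * p x| * Real.exp (N * (‖E‖ + 1) * traceSq x)) *
      Real.exp (-(N * (η / 4 * (symSq x * symSq x).trace))) := by
  rw [Finset.sum_mul]
  refine (norm_sum_le _ _).trans (Finset.sum_le_sum fun i _ => ?_)
  have hproj : ‖(ContinuousLinearMap.proj i : (Fin N → ℝ) →L[ℝ] ℝ)‖ ≤ 1 :=
    ContinuousLinearMap.opNorm_le_bound _ zero_le_one fun v => by
      rw [one_mul]; exact norm_le_pi_norm v i
  have hE' : ‖E'‖ ≤ ‖E‖ + 1 := by
    have := norm_sub_norm_le E' E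
    linarith
  refine (norm_smul_le_abs_of_norm_le_one _ hproj).trans ?_
  rw [abs_mul _ (weight _ _ _), weight_eq, abs_mul (Real.exp _), abs_of_pos (Real.exp_pos _),
    abs_of_pos (Real.exp_pos _), ← mul_assoc]
  exact mul_le_mul_of_nonneg_right
    (mul_le_mul_of_nonneg_left (exp_neg_sum_symSq_le hE' x) (abs_nonneg _)) (Real.exp_pos _).le

theorem hasFDerivAt_expect (hη : 0 < η) (hp : Tame p) (E : Fin N → ℝ) :
    HasFDerivAt (expect η p) (∑ i, expect η (fun x => -(N * symSq x i i) * p x) E •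
      (ContinuousLinearMap.proj i : (Fin N → ℝ) →L[ℝ] ℝ)) E := by
  have hint := fun i => (hp.neg_symSq_mul i).integrable hη E
  have hbound : Tame fun x => ∑ i, |-(N * symSq x i i) * p x| *
      Real.exp (N * (‖E‖ + 1) * traceSq x) :=
    Tame.sum fun i _ => (hp.neg_symSq_mul i).abs.mul (Tame.exp_traceSq (by positivity))
  have key := hasFDerivAt_integral_of_dominated_of_fderiv_le
    (F := fun E x => p x * weight η (Matrix.diagonal E) x)
    (F' := fun E x => ∑ i, (-(N * symSq x i i) * p x * weight η (Matrix.diagonal E) x) •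
      (ContinuousLinearMap.proj i : (Fin N → ℝ) →L[ℝ] ℝ))
    (bound := fun x => (∑ i, |-(N * symSq x i i) * p x| *
      Real.exp (N * (‖E‖ + 1) * traceSq x)) *
        Real.exp (-(N * (η / 4 * (symSq x * symSq x).trace))))
    (Metric.ball_mem_nhds E one_pos)
    (Filter.Eventually.of_forall fun E' => (hp.integrable hη E').aestronglyMeasurable)
    (hp.integrable hη E)
    (integrable_sum_smul Finset.univ _ fun i _ => hint i).aestronglyMeasurable
    (ae_of_all _ fun x E' hE' => norm_deriv_weight_le (mem_ball_iff_norm.1 hE') x)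
    (hbound.integrable_mul_exp hη) (ae_of_all _ fun x E' _ => hasFDerivAt_mul_weight _ E' x)
  exact key.congr_fderiv (integral_sum_smul Finset.univ _ fun i _ => hint i)

theorem partialE_expect (hη : 0 < η) (hp : Tame p) (i : Fin N) :
    partialE i (expect η p) = expect η fun x => -(N * symSq x i i) * p x := by
  funext E
  rw [partialE, (hasFDerivAt_expect hη hp E).fderiv]
  simp [Pi.single_apply]

/-- The derivative of an expectation is a combination of expectations of tame functions, so the
class is closed under differentiation and the induction runs over all `p` at once. -/
theorem contDiff_expect (hη : 0 < η) (hp : Tame p) : ContDiff ℝ ∞ (expect η p) := by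
  rw [contDiff_infty]
  intro n
  induction n generalizing p with
  | zero =>
    exact contDiff_zero.2 (continuous_iff_continuousAt.2 fun E =>
      (hasFDerivAt_expect hη hp E).continuousAt)
  | succ n ih =>
    refine contDiff_succ_iff_hasFDerivAt.2 ⟨_, ?_, fun E => hasFDerivAt_expect hη hp E⟩
    exact ContDiff.sum fun i _ => (ih (hp.neg_symSq_mul i)).smul contDiff_const

end

section

/-! ### Integration by parts along linear vector fields -/

theorem integral_coord_mul_fderiv {ι : Type*} [Fintype ι] [DecidableEq ι] {g : (ι → ℝ) → ℝ}
    (hg : Differentiable ℝ g) (hgi : Integrable g) (a c : ι)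
    (h₁ : Integrable fun x => x a * fderiv ℝ g x (Pi.single c 1))
    (h₂ : Integrable fun x => x a * g x) :
    ∫ x, x a * fderiv ℝ g x (Pi.single c 1) = -((if a = c then 1 else 0) * ∫ x, g x) := by
  have hd (x : ι → ℝ) : fderiv ℝ (fun x : ι → ℝ => x a) x (Pi.single c 1) =
      if a = c then 1 else 0 := by
    rw [(hasFDerivAt_apply (𝕜 := ℝ) a x).fderiv]
    simp [Pi.single_apply]
  rw [integral_mul_fderiv_eq_neg_fderiv_mul_of_integrable _ h₁ h₂
    (fun x _ => (hasFDerivAt_apply (𝕜 := ℝ) a x).differentiableAt) fun x _ => hg x]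
  · simp only [hd]
    rw [integral_const_mul]
  · simp only [hd]
    exact hgi.const_mul _

/-- The divergence of a linear vector field is its trace; in coordinates only the fields `x_a ∂_c`
need to be integrated by parts. -/
theorem integral_fderiv_linearMap {ι : Type*} [Fintype ι] [DecidableEq ι] {g : (ι → ℝ) → ℝ}
    (hg : Differentiable ℝ g) (hgi : Integrable g)
    (h₁ : ∀ a c, Integrable fun x => x a * fderiv ℝ g x (Pi.single c 1))
    (h₂ : ∀ a, Integrable fun x => x a * g x) (V : (ι → ℝ) →ₗ[ℝ] (ι → ℝ)) :
    ∫ x, fderiv ℝ g x (V x) = -((∑ a, V (Pi.single a 1) a) * ∫ x, g x) := by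
  have hV (x : ι → ℝ) : fderiv ℝ g x (V x) =
      ∑ a, ∑ c, V (Pi.single a 1) c * (x a * fderiv ℝ g x (Pi.single c 1)) := by
    have e₁ : V x = ∑ a, x a • V (Pi.single a 1) := by
      conv_lhs => rw [pi_eq_sum_univ' x]
      simp only [map_sum, map_smul]
    have e₂ (v : ι → ℝ) : fderiv ℝ g x v = ∑ c, v c * fderiv ℝ g x (Pi.single c 1) := by
      conv_lhs => rw [pi_eq_sum_univ' v]
      simp only [map_sum, map_smul, smul_eq_mul]
    rw [e₁, map_sum]
    refine Finset.sum_congr rfl fun a _ => ?_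
    rw [map_smul, e₂, smul_eq_mul, Finset.mul_sum]
    exact Finset.sum_congr rfl fun c _ => mul_left_comm _ _ _
  simp only [hV]
  rw [integral_finsetSum _ fun a _ => integrable_finsetSum _ fun c _ => (h₁ a c).const_mul _,
    Finset.sum_mul, ← Finset.sum_neg_distrib]
  refine Finset.sum_congr rfl fun a _ => ?_
  rw [integral_finsetSum _ fun c _ => (h₁ a c).const_mul _]
  simp only [integral_const_mul, integral_coord_mul_fderiv hg hgi a _ (h₁ a _) (h₂ a)]
  simp

/-! ### Scaling and rotation Ward identities -/

variable {N : ℕ} {η : ℝ}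

/-- The derivative of `Φ ↦ Φ²` in the direction `v`. -/
def symSqDeriv (x v : UpperIndex N → ℝ) : Matrix (Fin N) (Fin N) ℝ :=
  symMatrix x * symMatrix v + symMatrix v * symMatrix x

/-- The derivative of the action in the direction `v`. -/
def actionDeriv (η : ℝ) (E : Fin N → ℝ) (x v : UpperIndex N → ℝ) : ℝ :=
  N * ∑ i, E i * symSqDeriv x v i i +
    N * (η / 4 * (symSqDeriv x v * symSq x + symSq x * symSqDeriv x v).trace)

theorem hasDerivAt_matrix_mul {A B : ℝ → Matrix (Fin N) (Fin N) ℝ}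
    {A' B' : Matrix (Fin N) (Fin N) ℝ} {t : ℝ}
    (hA : ∀ i j, HasDerivAt (fun t => A t i j) (A' i j) t)
    (hB : ∀ i j, HasDerivAt (fun t => B t i j) (B' i j) t) (i j : Fin N) :
    HasDerivAt (fun t => (A t * B t) i j) ((A' * B t + A t * B') i j) t := by
  simp only [Matrix.add_apply, Matrix.mul_apply, ← Finset.sum_add_distrib]
  exact HasDerivAt.fun_sum fun k _ => (hA i k).mul (hB k j)

theorem hasDerivAt_symSq (x v : UpperIndex N → ℝ) (i j : Fin N) :
    HasDerivAt (fun t : ℝ => symSq (x + t • v) i j) (symSqDeriv x v i j) 0 := by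
  have h (i j : Fin N) : HasDerivAt (fun t : ℝ => symMatrix (x + t • v) i j)
      (symMatrix v i j) 0 := by
    have := ((hasDerivAt_id (0 : ℝ)).mul_const (symMatrix v i j)).const_add (symMatrix x i j)
    rw [one_mul] at this
    exact this
  have := hasDerivAt_matrix_mul h h i j
  rw [zero_smul, add_zero, add_comm] at this
  exact this

theorem hasDerivAt_action (E : Fin N → ℝ) (x v : UpperIndex N → ℝ) :
    HasDerivAt (fun t : ℝ => action η (Matrix.diagonal E) (symMatrix (x + t • v)))
      (actionDeriv η E x v) 0 := by
  simp only [action_eq]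
  have h₁ : HasDerivAt (fun t : ℝ => ∑ i, E i * symSq (x + t • v) i i)
      (∑ i, E i * symSqDeriv x v i i) 0 :=
    HasDerivAt.fun_sum fun i _ => (hasDerivAt_symSq x v i i).const_mul _
  have h₂ : HasDerivAt (fun t : ℝ => (symSq (x + t • v) * symSq (x + t • v)).trace)
      (symSqDeriv x v * symSq x + symSq x * symSqDeriv x v).trace 0 := by
    have := HasDerivAt.fun_sum (u := Finset.univ) fun i _ =>
      hasDerivAt_matrix_mul (hasDerivAt_symSq x v) (hasDerivAt_symSq x v) i i
    rw [zero_smul, add_zero] at this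
    exact this
  exact (h₁.const_mul _).add ((h₂.const_mul _).const_mul _)

theorem hasDerivAt_weight (E : Fin N → ℝ) (x v : UpperIndex N → ℝ) :
    HasDerivAt (fun t : ℝ => weight η (Matrix.diagonal E) (x + t • v))
      (-actionDeriv η E x v * weight η (Matrix.diagonal E) x) 0 := by
  have := (hasDerivAt_action (η := η) E x v).neg.exp
  simpa [weight, mul_comm] using this

theorem differentiable_symMatrix (i j : Fin N) :
    Differentiable ℝ fun x => symMatrix x i j :=
  differentiable_apply _

theorem differentiable_matrix_mul {A B : (UpperIndex N → ℝ) → Matrix (Fin N) (Fin N) ℝ}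
    (hA : ∀ i j, Differentiable ℝ fun x => A x i j)
    (hB : ∀ i j, Differentiable ℝ fun x => B x i j) (i j : Fin N) :
    Differentiable ℝ fun x => (A x * B x) i j := by
  simp only [Matrix.mul_apply]
  exact Differentiable.fun_sum fun k _ => (hA i k).mul (hB k j)

theorem differentiable_symSq (i j : Fin N) : Differentiable ℝ fun x => symSq x i j :=
  differentiable_matrix_mul differentiable_symMatrix differentiable_symMatrix i j

theorem differentiable_weight (E : Fin N → ℝ) :
    Differentiable ℝ (weight η (Matrix.diagonal E)) := by
  have h₁ : Differentiable ℝ fun x : UpperIndex N → ℝ => ∑ i, E i * symSq x i i :=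
    Differentiable.fun_sum fun i _ => (differentiable_symSq i i).const_mul _
  have h₂ : Differentiable ℝ fun x : UpperIndex N → ℝ => (symSq x * symSq x).trace :=
    Differentiable.fun_sum fun i _ =>
      differentiable_matrix_mul differentiable_symSq differentiable_symSq i i
  have h₃ : weight η (Matrix.diagonal E) = fun x => Real.exp (-(N * ∑ i, E i * symSq x i i +
      N * (η / 4 * (symSq x * symSq x).trace))) := by
    funext x
    rw [weight, action_eq]
  rw [h₃]
  exact ((h₁.const_mul _).add ((h₂.const_mul _).const_mul _)).neg.exp

theorem fderiv_eq_of_hasDerivAt {g : (UpperIndex N → ℝ) → ℝ} {x v : UpperIndex N → ℝ} {g' : ℝ}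
    (hg : Differentiable ℝ g) (h : HasDerivAt (fun t : ℝ => g (x + t • v)) g' 0) :
    fderiv ℝ g x v = g' := by
  have h' : HasLineDerivAt ℝ g g' x v := h
  rw [← h'.lineDeriv, (hg x).lineDeriv_eq_fderiv]

theorem Tame.symSqDeriv (v : UpperIndex N → ℝ) (i j : Fin N) :
    Tame fun x => symSqDeriv x v i j :=
  (Tame.matrix_mul (B := fun _ => symMatrix v) Tame.symMatrix_apply
    (fun _ _ => Tame.const _) i j).add
    (Tame.matrix_mul (A := fun _ => symMatrix v) (fun _ _ => Tame.const _)
      Tame.symMatrix_apply i j)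

theorem Tame.actionDeriv (E : Fin N → ℝ) (v : UpperIndex N → ℝ) :
    Tame fun x => actionDeriv η E x v :=
  ((Tame.const _).mul (Tame.sum fun i _ => (Tame.const _).mul (Tame.symSqDeriv v i i))).add
    ((Tame.const _).mul ((Tame.const _).mul (Tame.matrix_trace fun i j =>
      (Tame.matrix_mul (Tame.symSqDeriv v) Tame.symSq_apply i j).add
        (Tame.matrix_mul Tame.symSq_apply (Tame.symSqDeriv v) i j))))

/-- Invariance of the integral under the flow of a linear vector field `V`. -/
theorem integral_ward (hη : 0 < η) (E : Fin N → ℝ) {p : (UpperIndex N → ℝ) → ℝ}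
    {p' : (UpperIndex N → ℝ) → (UpperIndex N → ℝ) → ℝ} (hp : Tame p)
    (hd : Differentiable ℝ p) (hp' : ∀ v, Tame fun x => p' x v)
    (hpp' : ∀ x v, HasDerivAt (fun t : ℝ => p (x + t • v)) (p' x v) 0)
    (V : (UpperIndex N → ℝ) →ₗ[ℝ] (UpperIndex N → ℝ)) :
    expect η (fun x => p' x (V x) - p x * actionDeriv η E x (V x)) E =
      -((∑ a, V (Pi.single a 1) a) * expect η p E) := by
  have hg : Differentiable ℝ fun x => p x * weight η (Matrix.diagonal E) x :=
    hd.mul (differentiable_weight E)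
  have hfd (x v) : fderiv ℝ (fun x => p x * weight η (Matrix.diagonal E) x) x v =
      (p' x v - p x * actionDeriv η E x v) * weight η (Matrix.diagonal E) x := by
    refine fderiv_eq_of_hasDerivAt hg ?_
    have := (hpp' x v).mul (hasDerivAt_weight (η := η) E x v)
    rw [zero_smul, add_zero] at this
    refine this.congr_deriv ?_
    ring
  have key := integral_fderiv_linearMap hg (hp.integrable hη E) (fun a c => ?_) (fun a => ?_) V
  · simpa only [hfd, expect] using key
  · simp only [hfd, ← mul_assoc]
    exact ((Tame.coord a).mul ((hp' _).sub (hp.mul (Tame.actionDeriv E _)))).integrable hη E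
  · simp only [← mul_assoc]
    exact ((Tame.coord a).mul hp).integrable hη E

theorem card_upperIndex (N : ℕ) : (Fintype.card (UpperIndex N) : ℝ) = N * (N + 1) / 2 := by
  rw [← Fintype.card_congr (Sym2.sortEquiv (α := Fin N)), Sym2.card, Fintype.card_fin,
    Nat.choose_two_right, Nat.add_sub_cancel, Nat.cast_div_charZero]
  · push_cast
    ring
  · exact (Nat.even_mul_succ_self N).two_dvd.trans (by rw [mul_comm])

/-- The scaling identity. -/
theorem expect_scaling (hη : 0 < η) (E : Fin N → ℝ) :
    expect η (fun x => N * (2 * ∑ i, E i * symSq x i i +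
      η * ∑ i, ∑ j, symSq x i j ^ 2)) E = N * (N + 1) / 2 * Z N η E := by
  have h := integral_ward (η := η) hη E (p := fun _ => 1) (p' := fun _ _ => 0) (Tame.const 1)
    (differentiable_const _) (fun _ => Tame.const 0) (fun _ _ => hasDerivAt_const _ _)
    LinearMap.id
  -- Euler's identity: the two parts of the action have degrees two and four, so `η/4` becomes `η`.
  have h₁ (x : UpperIndex N → ℝ) : actionDeriv η E x x =
      N * (2 * ∑ i, E i * symSq x i i + η * ∑ i, ∑ j, symSq x i j ^ 2) := by
    have h₂ : symSqDeriv x x = (2 : ℝ) • symSq x := (two_smul ℝ (symSq x)).symm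
    rw [actionDeriv, h₂, Matrix.smul_mul, Matrix.mul_smul, ← add_smul, Matrix.trace_smul,
      trace_symSq_mul_symSq]
    simp only [Matrix.smul_apply, smul_eq_mul, mul_left_comm (E _) 2, ← Finset.mul_sum]
    ring
  have h₃ : ∑ a : UpperIndex N, LinearMap.id (R := ℝ) (Pi.single a (1 : ℝ)) a =
      N * (N + 1) / 2 := by
    simp [← card_upperIndex]
  have h₄ : expect η (fun x => (0 : ℝ) - 1 * actionDeriv η E x (LinearMap.id (R := ℝ) x)) E =
      -expect η (fun x => N * (2 * ∑ i, E i * symSq x i i +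
        η * ∑ i, ∑ j, symSq x i j ^ 2)) E := by
    simp only [LinearMap.id_apply, h₁, zero_sub, one_mul]
    rw [← neg_one_mul (expect _ _ _), ← expect_const_mul]
    simp only [neg_one_mul]
  rw [h₄, h₃, neg_inj, ← Z_eq_expect] at h
  exact h

/-- The vector field `Φ ↦ AΦ - ΦA`. -/
def rotationField (A : Matrix (Fin N) (Fin N) ℝ) :
    (UpperIndex N → ℝ) →ₗ[ℝ] (UpperIndex N → ℝ) where
  toFun x c := (A * symMatrix x - symMatrix x * A) c.1.1 c.1.2
  map_add' x y := by
    have h : symMatrix (x + y) = symMatrix x + symMatrix y := rfl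
    funext c
    simp only [h, Matrix.mul_add, Matrix.add_mul, Matrix.sub_apply, Matrix.add_apply,
      Pi.add_apply]
    ring
  map_smul' t x := by
    have h : symMatrix (t • x) = t • symMatrix x := rfl
    funext c
    simp only [h, Matrix.mul_smul, Matrix.smul_mul, Matrix.sub_apply, Matrix.smul_apply,
      Pi.smul_apply, RingHom.id_apply, smul_sub]

theorem symMatrix_transpose (x : UpperIndex N → ℝ) : (symMatrix x).transpose = symMatrix x :=
  Matrix.ext fun i j => symMatrix_comm x j i

/-- For antisymmetric `A` the commutator with a symmetric matrix is symmetric, hence determined by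
its upper triangle. -/
theorem symMatrix_rotationField {A : Matrix (Fin N) (Fin N) ℝ} (hA : A.transpose = -A)
    (x : UpperIndex N → ℝ) :
    symMatrix (rotationField A x) = A * symMatrix x - symMatrix x * A := by
  have hs : (A * symMatrix x - symMatrix x * A).transpose = A * symMatrix x - symMatrix x * A := by
    rw [Matrix.transpose_sub, Matrix.transpose_mul, Matrix.transpose_mul, symMatrix_transpose, hA,
      Matrix.mul_neg, Matrix.neg_mul]
    abel
  ext i j
  change (A * symMatrix x - symMatrix x * A) (min i j) (max i j) = _
  rcases le_total i j with h | h
  · rw [min_eq_left h, max_eq_right h]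
  · rw [min_eq_right h, max_eq_left h]
    exact congrFun (congrFun hs i) j

/-- The coefficient of `Φ_{kl}` in its own component involves only `A_{kk}` and `A_{ll}`. Rotations
are therefore divergence free and contribute no Jacobian term. -/
theorem rotationField_single {A : Matrix (Fin N) (Fin N) ℝ} (hA : ∀ i, A i i = 0)
    (a : UpperIndex N) : rotationField A (Pi.single a 1) a = 0 := by
  obtain ⟨⟨k, l⟩, hkl⟩ := a
  change k ≤ l at hkl
  have h₁ (m : Fin N) (hm : m ≠ k) :
      symMatrix (Pi.single (⟨(k, l), hkl⟩ : UpperIndex N) (1 : ℝ)) m l = 0 := by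
    refine Pi.single_eq_of_ne (fun h => ?_) _
    have h' := congrArg Subtype.val h
    simp only [Prod.mk.injEq] at h'
    obtain ⟨h₁, h₂⟩ := h'
    rcases le_total m l with hml | hml
    · exact hm (by rwa [min_eq_left hml] at h₁)
    · rw [min_eq_right hml] at h₁
      rw [max_eq_left hml] at h₂
      exact hm (h₂.trans h₁)
  have h₂ (m : Fin N) (hm : m ≠ l) :
      symMatrix (Pi.single (⟨(k, l), hkl⟩ : UpperIndex N) (1 : ℝ)) k m = 0 := by
    refine Pi.single_eq_of_ne (fun h => ?_) _
    have h' := congrArg Subtype.val h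
    simp only [Prod.mk.injEq] at h'
    obtain ⟨h₁, h₂⟩ := h'
    rcases le_total k m with hml | hml
    · exact hm (by rwa [max_eq_right hml] at h₂)
    · rw [min_eq_right hml] at h₁
      rw [max_eq_left hml] at h₂
      exact hm (h₁.trans h₂)
  change (A * symMatrix (Pi.single (⟨(k, l), hkl⟩ : UpperIndex N) (1 : ℝ)) -
    symMatrix (Pi.single (⟨(k, l), hkl⟩ : UpperIndex N) (1 : ℝ)) * A) k l = 0
  rw [Matrix.sub_apply, Matrix.mul_apply, Matrix.mul_apply,
    Finset.sum_eq_zero, Finset.sum_eq_zero, sub_zero]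
  · intro m _
    by_cases hm : m = l
    · rw [hm, hA, mul_zero]
    · rw [h₂ m hm, zero_mul]
  · intro m _
    by_cases hm : m = k
    · rw [hm, hA, zero_mul]
    · rw [h₁ m hm, mul_zero]

/-- The Ward identity of the rotation in the `(i, j)`-plane. -/
theorem expect_ward (hη : 0 < η) (E : Fin N → ℝ) {i j : Fin N} (hij : i ≠ j) :
    2 * N * (E i - E j) * expect η (fun x => symSq x i j ^ 2) E =
      expect η (fun x => symSq x j j) E - expect η (fun x => symSq x i i) E := by
  set A : Matrix (Fin N) (Fin N) ℝ := Matrix.single i j 1 - Matrix.single j i 1 with hA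
  have hAt : A.transpose = -A := by
    rw [hA, Matrix.transpose_sub, Matrix.transpose_single, Matrix.transpose_single, neg_sub]
  have hA₀ (k : Fin N) : A k k = 0 := by
    have h₁ : ¬(i = k ∧ j = k) := fun h => hij (h.1.trans h.2.symm)
    have h₂ : ¬(j = k ∧ i = k) := fun h => hij (h.2.trans h.1.symm)
    rw [hA, Matrix.sub_apply, Matrix.single_apply, Matrix.single_apply, if_neg h₁, if_neg h₂,
      sub_zero]
  have h := integral_ward (η := η) hη E (p := fun x => symSq x i j)
    (p' := fun x v => symSqDeriv x v i j) (Tame.symSq_apply i j) (differentiable_symSq i j)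
    (fun v => Tame.symSqDeriv v i j) (fun x v => hasDerivAt_symSq x v i j) (rotationField A)
  have hX (x : UpperIndex N → ℝ) : symSqDeriv x (rotationField A x) =
      A * symSq x - symSq x * A := by
    rw [symSqDeriv, symMatrix_rotationField hAt, symSq]
    noncomm_ring
  have hXkl (x : UpperIndex N → ℝ) (k l : Fin N) : (A * symSq x - symSq x * A) k l =
      (if k = i then symSq x j l else 0) - (if k = j then symSq x i l else 0) -
        ((if l = j then symSq x k i else 0) - (if l = i then symSq x k j else 0)) := by
    simp [hA, Matrix.sub_mul, Matrix.mul_sub, Matrix.mul_apply, Matrix.single_apply, ite_and,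
      eq_comm]
  have h₁ (x : UpperIndex N → ℝ) : symSqDeriv x (rotationField A x) i j =
      symSq x j j - symSq x i i := by
    rw [hX, hXkl]
    simp [hij, hij.symm]
  -- The quartic term is rotation invariant; only the source `E` breaks the symmetry, and it
  -- reproduces the observable `(Φ²)_{ij}`.
  have h₂ (x : UpperIndex N → ℝ) : actionDeriv η E x (rotationField A x) =
      2 * N * (E i - E j) * symSq x i j := by
    have t : ((A * symSq x - symSq x * A) * symSq x +
        symSq x * (A * symSq x - symSq x * A)).trace = 0 := by
      have : (A * symSq x - symSq x * A) * symSq x + symSq x * (A * symSq x - symSq x * A) =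
          A * (symSq x * symSq x) - (symSq x * symSq x) * A := by noncomm_ring
      rw [this, Matrix.trace_sub, Matrix.trace_mul_comm, sub_self]
    rw [actionDeriv, hX, t, mul_zero, mul_zero, add_zero]
    simp only [hXkl, mul_sub, Finset.sum_sub_distrib, mul_ite, mul_zero, Finset.sum_ite_eq',
      Finset.mem_univ, if_true, symSq_comm x j i]
    ring
  have h₃ : ∑ a, rotationField A (Pi.single a 1) a = 0 :=
    Finset.sum_eq_zero fun a _ => rotationField_single hA₀ a
  simp only [h₁, h₂] at h
  rw [h₃, zero_mul, neg_zero, expect_sub hη ((Tame.symSq_apply j j).sub (Tame.symSq_apply i i))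
    ((Tame.symSq_apply i j).mul ((Tame.const _).mul (Tame.symSq_apply i j))),
    expect_sub hη (Tame.symSq_apply j j) (Tame.symSq_apply i i), sub_eq_zero] at h
  rw [h, ← expect_const_mul]
  congr 1
  funext x
  ring

end

/-! ### Permutation symmetry and the Schwinger-Dyson equation for `Z` -/

section

variable {N : ℕ} {η : ℝ}

/-- The permutation of the independent matrix entries induced by a permutation of the indices. -/
def upperIndexPerm (σ : Equiv.Perm (Fin N)) : Equiv.Perm (UpperIndex N) :=
  Sym2.sortEquiv.symm.trans
    (Equiv.trans ⟨Sym2.map σ, Sym2.map σ.symm, fun z => by simp [Sym2.map_map],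
      fun z => by simp [Sym2.map_map]⟩ Sym2.sortEquiv)

theorem symMatrix_comp_upperIndexPerm (σ : Equiv.Perm (Fin N)) (x : UpperIndex N → ℝ) :
    symMatrix (x ∘ upperIndexPerm σ) = (symMatrix x).submatrix σ σ := by
  ext i j
  change x (Sym2.sortEquiv (Sym2.map σ s(min i j, max i j))) = x (Sym2.sortEquiv s(σ i, σ j))
  congr 2
  rcases le_total i j with h | h
  · rw [min_eq_left h, max_eq_right h, Sym2.map_mk]
  · rw [min_eq_right h, max_eq_left h, Sym2.map_mk, Sym2.eq_swap]

theorem weight_comp_perm (σ : Equiv.Perm (Fin N)) (E : Fin N → ℝ) (x : UpperIndex N → ℝ) :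
    weight η (Matrix.diagonal (E ∘ σ)) (x ∘ upperIndexPerm σ) =
      weight η (Matrix.diagonal E) x := by
  have h : symSq (x ∘ upperIndexPerm σ) = (symSq x).submatrix σ σ := by
    rw [symSq, symMatrix_comp_upperIndexPerm, Matrix.submatrix_mul_equiv, symSq]
  have h₁ : ∑ i, (E ∘ σ) i * symSq (x ∘ upperIndexPerm σ) i i = ∑ i, E i * symSq x i i := by
    rw [h]
    exact Equiv.sum_comp σ fun i => E i * symSq x i i
  have h₂ : (symSq (x ∘ upperIndexPerm σ) * symSq (x ∘ upperIndexPerm σ)).trace =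
      (symSq x * symSq x).trace := by
    rw [h, Matrix.submatrix_mul_equiv]
    exact Equiv.sum_comp σ fun i => (symSq x * symSq x) i i
  rw [weight_eq, weight_eq, h₁, h₂]

/-- Relabelling the independent entries preserves Lebesgue measure, and the trace is unchanged when
`E` and `Φ` are permuted simultaneously. -/
theorem Z_comp_perm (σ : Equiv.Perm (Fin N)) (E : Fin N → ℝ) : Z N η (E ∘ σ) = Z N η E := by
  have h := (volume_measurePreserving_piCongrLeft (fun _ : UpperIndex N => ℝ)
    (upperIndexPerm σ).symm).integral_comp' (weight η (Matrix.diagonal (E ∘ σ)))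
  rw [Z, partitionFunction, ← h, Z, partitionFunction]
  refine integral_congr_ae (ae_of_all _ fun x => ?_)
  have hx : MeasurableEquiv.piCongrLeft (fun _ : UpperIndex N => ℝ) (upperIndexPerm σ).symm x =
      x ∘ upperIndexPerm σ := by
    funext c
    have := MeasurableEquiv.piCongrLeft_apply_apply (β := fun _ : UpperIndex N => ℝ)
      (upperIndexPerm σ).symm x (upperIndexPerm σ c)
    rwa [Equiv.symm_apply_apply] at this
  simp only [hx, weight_comp_perm]

theorem partialE_Z (hη : 0 < η) (i : Fin N) :
    partialE i (Z N η) = fun E => -N * expect η (fun x => symSq x i i) E := by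
  rw [Z_eq_expect, partialE_expect hη (Tame.const 1)]
  funext E
  rw [← expect_const_mul]
  congr 1
  funext x
  ring

theorem partialE_partialE_Z (hη : 0 < η) (i : Fin N) (E : Fin N → ℝ) :
    partialE i (partialE i (Z N η)) E = N ^ 2 * expect η (fun x => symSq x i i ^ 2) E := by
  rw [Z_eq_expect, partialE_expect hη (Tame.const 1),
    partialE_expect hη ((Tame.const 1).neg_symSq_mul i), ← expect_const_mul]
  congr 1
  funext x
  ring

/-- The Schwinger-Dyson equation for the partition function. -/
theorem LSD_Z (hN : 1 ≤ N) (hη : 0 < η) {E : Fin N → ℝ} (hE : E ∈ distinctPoints N) :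
    LSD N η (Z N η) E = 0 := by
  have hN₀ : (N : ℝ) ≠ 0 := by positivity
  set d : Fin N → ℝ := fun i => partialE i (Z N η) E with hd
  have hX (i : Fin N) : N * expect η (fun x => symSq x i i) E = -d i := by
    have := congrFun (partialE_Z hη i) E
    change _ = -partialE i (Z N η) E
    rw [this, neg_mul, neg_neg]
  have hsq (i j : Fin N) : Tame fun x => symSq x i j ^ 2 :=
    ((Tame.symSq_apply i j).mul (Tame.symSq_apply i j)).congr fun x => sq _
  -- The rotation identity divided by `E_i - E_j`, which is nonzero at distinct points.
  have hoff (i j : Fin N) (hij : j ≠ i) : N ^ 2 * expect η (fun x => symSq x i j ^ 2) E =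
      1 / 2 * (invDiff i j E * (d i - d j)) := by
    have h₁ := expect_ward hη E hij.symm
    have h₂ : E i - E j ≠ 0 := sub_ne_zero.2 fun h => hij (hE h).symm
    rw [invDiff]
    field_simp
    linear_combination (N : ℝ) * h₁ + hX j - hX i
  have hrow (i : Fin N) : N ^ 2 * ∑ j, expect η (fun x => symSq x i j ^ 2) E =
      partialE i (partialE i (Z N η)) E + 1 / 2 * ∑ j, invDiff i j E * (d i - d j) := by
    rw [partialE_partialE_Z hη, ← Finset.add_sum_erase _ _ (Finset.mem_univ i), mul_add,
      Finset.mul_sum, Finset.sum_congr rfl fun j hj => hoff i j (Finset.ne_of_mem_erase hj),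
      ← Finset.mul_sum, Finset.sum_erase]
    simp
  have hall : N ^ 2 * ∑ i, ∑ j, expect η (fun x => symSq x i j ^ 2) E =
      ∑ i, partialE i (partialE i (Z N η)) E + ∑ i, ∑ j, invDiff i j E * d i := by
    rw [Finset.mul_sum, Finset.sum_congr rfl fun i _ => hrow i, Finset.sum_add_distrib,
      ← Finset.mul_sum, sum_invDiff_antisymm]
  have hscale := expect_scaling hη E
  rw [expect_const_mul, expect_add hη
      ((Tame.const 2).mul (Tame.sum fun i _ => (Tame.const (E i)).mul (Tame.symSq_apply i i)))
      ((Tame.const η).mul (Tame.sum fun i _ => Tame.sum fun j _ => hsq i j)),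
    expect_const_mul, expect_const_mul,
    expect_sum hη fun i _ => (Tame.const (E i)).mul (Tame.symSq_apply i i),
    expect_sum hη fun i _ => Tame.sum fun j _ => hsq i j,
    Finset.sum_congr rfl fun i _ => expect_const_mul (E i) E,
    Finset.sum_congr rfl fun i _ => expect_sum hη (fun j _ => hsq i j) E] at hscale
  have hlin : N * ∑ i, E i * expect η (fun x => symSq x i i) E = -∑ i, E i * d i := by
    rw [Finset.mul_sum, ← Finset.sum_neg_distrib]
    exact Finset.sum_congr rfl fun i _ => by rw [mul_left_comm, hX, mul_neg]
  rw [LSD]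
  simp only [sum_erase_invDiff _ E fun _ => _]
  change η / N * ∑ i, partialE i (partialE i (Z N η)) E +
    η / N * ∑ i, ∑ j, invDiff i j E * d i - 2 * ∑ k, E k * d k - _ = 0
  -- The scaling identity replaces `N(N+1)/2 · Z`; its quartic part cancels the second-order and
  -- `1/(E_i - E_l)` terms, and its quadratic part cancels the Euler term through `hlin`.
  rw [← hscale, ← mul_add, ← hall]
  field_simp
  linear_combination -2 * hlin

end

end SymPhi4

end

theorem theorem4p1 (N : ℕ) (hN : 1 ≤ N) (η : ℝ) (hη : 0 < η) (α : ℝ) (m : ℤ) (hm : -1 ≤ m) :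
    (∀ E : Fin N → ℝ, Integrable (SymPhi4.weight η (Matrix.diagonal E))) ∧
    ContDiff ℝ ∞ (SymPhi4.Z N η) ∧
    ContDiffOn ℝ ∞ (SymPhi4.virasoroConj N η α m (SymPhi4.Z N η)) (SymPhi4.distinctPoints N) ∧
    ∀ E ∈ SymPhi4.distinctPoints N,
      SymPhi4.LSD N η (SymPhi4.virasoroConj N η α m (SymPhi4.Z N η)) E =
        -2 * (m : ℝ) * SymPhi4.virasoroConj N η α m (SymPhi4.Z N η) E := by
  have hZ : ContDiff ℝ ∞ (SymPhi4.Z N η) := by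
    rw [SymPhi4.Z_eq_expect]
    exact SymPhi4.contDiff_expect hη (SymPhi4.Tame.const 1)
  refine ⟨fun E => ?_, hZ, SymPhi4.LSD_virasoroConj hN hη α hm hZ.contDiffOn
    SymPhi4.Z_comp_perm fun E hE => SymPhi4.LSD_Z hN hη hE⟩
  simpa only [one_mul] using (SymPhi4.Tame.const 1).integrable hη E
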